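/- Let $n,p\ge 1$ be integers, $\sigma>0$, and let $\mathbb X\in\mathbf R^{n\times p}$ be a deterministic matrix such that all diagonal entries of $\mathbb X^T\mathbb X/n$ equal $1$. Let $1\le s\le p$ and let $\beta^*\in\mathbf R^p$ have at most $s$ nonzero coordinates. We observe $y=\mathbb X\beta^*+\xi$ with $\xi\sim\mathcal N(0,\sigma^2 I_{n\times n})$. Write $|\cdot|_1,|\cdot|_2$ for the $\ell_1$ and Euclidean norms, $\|u\|^2=\frac1n|u|_2^2$ for $u\in\mathbf R^n$, $\phi_{max}$ for the largest eigenvalue of $\mathbb X^T\mathbb X/n$, and $$\kappa=\kappa(s,3)=\min_{|T|\le s}\ \min_{\delta:\ |\delta_{T^c}|_1\le 3|\delta_T|_1,\ \delta_T\neq 0}\ \frac{|\mathbb X\delta|_2}{\sqrt n\,|\delta_T|_2},$$ where $T$ ranges over the subsets of $\{1,\dots,p\}$. Assume the restricted eigenvalue condition $RE(s,3)$, that is, $\kappa>0$. For every $\lambda\ge 0$ let $\hat\beta_\lambda$ be any minimizer over $\beta\in\mathbf R^p$ of $\frac1{2n}|y-\mathbb X\beta|_2^2+\lambda|\beta|_1$,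 and let $\hat F=\{\mathrm{supp}(\hat\beta_\lambda):\lambda\ge 0\}$ be the finite family of all supports that appear on the Lasso path. For $T\subset\{1,\dots,p\}$ let $\Pi_T$ be the orthogonal projection onto the span of the columns of $\mathbb X$ with index in $T$, and let $$\pi_T=\Big(H_p\tbinom{p}{|T|}e^{|T|}\Big)^{-1},\qquad H_p=\frac{e-e^{-p}}{e-1}.$$ For $\theta$ in the simplex $\{\theta\in[0,\infty)^{\hat F}:\sum_{T\in\hat F}\theta_T=1\}$ put $\hat\mu_\theta=\sum_{T\in\hat F}\theta_T\Pi_T y$ and $$H(\theta)=|\hat\mu_\theta-y|_2^2+\frac12\sum_{T\in\hat F}\theta_T|\Pi_Ty-\hat\mu_\theta|_2^2+26\sigma^2\sum_{T\in\hat F}\theta_T\log\frac1{\pi_T}.$$ Let $\hat\mu=\hat\mu_{\hat\theta}$, where $\hat\theta$ is any minimizer of $H$ over the simplex. Then for every $x>0$, with probability at least $1-3e^{-x}$, $$\|\hat\mu-\mathbb X\beta^*\|^2\le\frac{(128+48\phi_{max})\sigma^2 s\log p}{\kappa^2 n}+\frac{24\sigma^2}{n}+\frac{128\sigma^2 s x}{\kappa^2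 n}+\frac{22\sigma^2x}{n}.$$ Furthermore, the prediction loss is integrable and $$\mathbb E\|\hat\mu-\mathbb X\beta^*\|^2\le\frac{(128+48\phi_{max})\sigma^2 s\log p}{\kappa^2 n}+\frac{384\sigma^2 s}{\kappa^2 n}+\frac{90\sigma^2}{n}.$$ -/

import Mathlib

open scoped Matrix

noncomputable section

namespace LassoAgg

variable {n p : ℕ}

/-- The vector `X β`, as an element of Euclidean space. -/
def fit (X : Matrix (Fin n) (Fin p) ℝ) (β : Fin p → ℝ) : EuclideanSpace ℝ (Fin n) :=
  WithLp.toLp 2 (X *ᵥ β)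

/-- The `j`-th column of `X`. -/
def column (X : Matrix (Fin n) (Fin p) ℝ) (j : Fin p) : EuclideanSpace ℝ (Fin n) :=
  WithLp.toLp 2 (fun i => X i j)

/-- The empirical squared norm `(1/n) ∑ uᵢ²`. -/
def empLoss (u : EuclideanSpace ℝ (Fin n)) : ℝ := (1 / (n : ℝ)) * ‖u‖ ^ 2

/-- The support of a coefficient vector; its cardinality is the `ℓ₀` norm. -/
def supp (β : Fin p → ℝ) : Finset (Fin p) := Finset.univ.filter (fun j => β j ≠ 0)

/-- The normalized Gram matrix `XᵀX / n`. -/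
def gram (X : Matrix (Fin n) (Fin p) ℝ) : Matrix (Fin p) (Fin p) ℝ :=
  (1 / (n : ℝ)) • (Xᵀ * X)

/-- The largest eigenvalue of `XᵀX / n`. -/
def phiMax (X : Matrix (Fin n) (Fin p) ℝ) : ℝ :=
  sSup {a : ℝ | Module.End.HasEigenvalue (Matrix.toLin' (gram X)) a}

/-- The ratios `|Xδ|₂ / (√n |δ_T|₂)` over supports `T` with `|T| ≤ s` and vectors `δ` with
`|δ_{Tᶜ}|₁ ≤ c₀ |δ_T|₁`. Vectors with `δ_T = 0`, for which the ratio is `0/0`, are left out. -/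
def reRatios (X : Matrix (Fin n) (Fin p) ℝ) (s : ℕ) (c₀ : ℝ) : Set ℝ :=
  {r : ℝ | ∃ (T : Finset (Fin p)) (δ : Fin p → ℝ), T.card ≤ s ∧
    ∑ j ∈ Tᶜ, |δ j| ≤ c₀ * ∑ j ∈ T, |δ j| ∧ (∃ j ∈ T, δ j ≠ 0) ∧
    r = ‖fit X δ‖ / (Real.sqrt n * Real.sqrt (∑ j ∈ T, δ j ^ 2))}

/-- The restricted eigenvalue constant `κ(s, c₀)`. -/
def kappa (X : Matrix (Fin n) (Fin p) ℝ) (s : ℕ) (c₀ : ℝ) : ℝ := sInf (reRatios X s c₀)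

/-- The restricted eigenvalue condition `RE(s, c₀)`. -/
def RE (X : Matrix (Fin n) (Fin p) ℝ) (s : ℕ) (c₀ : ℝ) : Prop := 0 < kappa X s c₀

/-- The Lasso objective `|y - Xβ|₂² / (2n) + lam |β|₁`. -/
def lassoObj (X : Matrix (Fin n) (Fin p) ℝ) (y : EuclideanSpace ℝ (Fin n)) (lam : ℝ)
    (β : Fin p → ℝ) : ℝ :=
  1 / (2 * (n : ℝ)) * ‖y - fit X β‖ ^ 2 + lam * ∑ j, |β j|

/-- `β` is a solution of the Lasso problem with tuning parameter `lam`
(a least squares solution if `lam = 0`). -/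
def IsLasso (X : Matrix (Fin n) (Fin p) ℝ) (y : EuclideanSpace ℝ (Fin n)) (lam : ℝ)
    (β : Fin p → ℝ) : Prop :=
  ∀ β' : Fin p → ℝ, lassoObj X y lam β ≤ lassoObj X y lam β'

/-- `path` selects, for every tuning parameter in `[0, ∞)`, a solution of the Lasso problem. -/
def IsLassoPath (X : Matrix (Fin n) (Fin p) ℝ) (y : EuclideanSpace ℝ (Fin n))
    (path : ℝ → Fin p → ℝ) : Prop :=
  ∀ lam : ℝ, 0 ≤ lam → IsLasso X y lam (path lam)

open Classical in
/-- The family of all supports that appear on the path. -/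
def pathSupports (path : ℝ → Fin p → ℝ) : Finset (Finset (Fin p)) :=
  Finset.univ.filter (fun T => ∃ lam : ℝ, 0 ≤ lam ∧ supp (path lam) = T)

/-- The least squares estimator `Π_T y`: orthogonal projection of `y` onto the span of the columns
of `X` with index in `T`. -/
def proj (X : Matrix (Fin n) (Fin p) ℝ) (T : Finset (Fin p)) (y : EuclideanSpace ℝ (Fin n)) :
    EuclideanSpace ℝ (Fin n) :=
  (Submodule.span ℝ (column X '' (T : Set (Fin p)))).starProjection y

/-- The normalizing constant `H_p = (e - e^{-p}) / (e - 1)`. -/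
def normConst (p : ℕ) : ℝ := (Real.exp 1 - Real.exp (-(p : ℝ))) / (Real.exp 1 - 1)

/-- The weight `π_T = (H_p * (p choose |T|) * e^{|T|})⁻¹` of a support `T`. -/
def weight (T : Finset (Fin p)) : ℝ :=
  (normConst p * (p.choose T.card : ℝ) * Real.exp (T.card : ℝ))⁻¹

/-- The simplex of weights on the finite family `F` (values outside `F` play no role). -/
def simplex (F : Finset (Finset (Fin p))) : Set (Finset (Fin p) → ℝ) :=
  {θ | ∑ T ∈ F, θ T = 1 ∧ ∀ T ∈ F, 0 ≤ θ T}

/-- The mixture `μ_θ = ∑ θ_T Π_T y` of the least squares estimators. -/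
def mix (X : Matrix (Fin n) (Fin p) ℝ) (F : Finset (Finset (Fin p)))
    (y : EuclideanSpace ℝ (Fin n)) (θ : Finset (Fin p) → ℝ) : EuclideanSpace ℝ (Fin n) :=
  ∑ T ∈ F, θ T • proj X T y

/-- The criterion
`|μ_θ - y|² + (1/2) ∑ θ_T |Π_T y - μ_θ|² + 26 v ∑ θ_T log (1/π_T)`,
where `v` is the (estimated or known) noise variance. -/
def qCrit (X : Matrix (Fin n) (Fin p) ℝ) (F : Finset (Finset (Fin p))) (v : ℝ)
    (y : EuclideanSpace ℝ (Fin n)) (θ : Finset (Fin p) → ℝ) : ℝ :=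
  ‖mix X F y θ - y‖ ^ 2
    + 1 / 2 * ∑ T ∈ F, θ T * ‖proj X T y - mix X F y θ‖ ^ 2
    + 26 * v * ∑ T ∈ F, θ T * Real.log (1 / weight T)

/-- `m` is a Q-aggregate of the supports in `F`: `m = μ_θ` for some minimizer `θ` of the criterion
over the simplex. -/
def IsQAggregate (X : Matrix (Fin n) (Fin p) ℝ) (F : Finset (Finset (Fin p))) (v : ℝ)
    (y : EuclideanSpace ℝ (Fin n)) (m : EuclideanSpace ℝ (Fin n)) : Prop :=
  ∃ θ ∈ simplex F, (∀ θ' ∈ simplex F, qCrit X F v y θ ≤ qCrit X F v y θ') ∧ m = mix X F y θ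

end LassoAgg

end

/-! Write f for Xβ*. The aggregate does not involve the tuning parameter, so it may be compared with
any one support on the path. The analysis picks the support T of the Lasso solution at the λ with
nλ² = 98σ²(log p + x), which is seven times the noise level σ√(2(log p + x)/n) of the columns.

The criterion equals half a squared distance to y plus a term linear in θ. A minimizer therefore
beats every vertex of the simplex with a quadratic margin (`simplex_minimizer_optimality`). The
remaining noise terms are dominated simultaneously for all supports by a union bound with the
weights π_T, which sum to one, so the randomness of the path costs nothing. The result is the oracle
inequality `norm_qAggregate_sub_sq_le`, with price 26σ² log(1/π_T), where log(1/π_T) is at most |T|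
log p + (3 + log p)/2.

For the chosen T, the projection residual is at most the Lasso residual, whose excess over |ξ|² is
bounded by a multiple of nλ²s/κ² through the restricted eigenvalue. Stationarity bounds |T| by a
multiple of φ_max s/κ²; the factor log p + x, present both in λ² and in the prediction error,
cancels (`IsLasso.bounds`). Three exceptional events, each of probability at most e^{-x}, give the
deviation bound, and integrating the tail gives the expectation. -/

namespace LassoAgg

open MeasureTheory ProbabilityTheory
open scoped RealInnerProductSpace ENNReal

/-! ### One-dimensional Gaussian tails and exponential moments -/

/-- Two-sided tail bound for the standard Gaussian distribution, with constant one. -/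
theorem gaussianReal_abs_gt_le {t : ℝ} (ht : 0 ≤ t) :
    gaussianReal 0 1 {z | t < |z|} ≤ ENNReal.ofReal (Real.exp (-(t ^ 2 / 2))) := by
  -- Shifting by e with |e| = t multiplies the density by at most exp(-t²/2) wherever ez ≥ 0. The
  -- two tails are shifts of the two half-lines, whose total mass is at most one; hence no factor 2.
  have key : ∀ (e : ℝ) (s : Set ℝ), MeasurableSet s → (∀ z ∈ s, 0 ≤ e * z) → |e| = t →
      ∫⁻ z in (fun z => z - e) ⁻¹' s, gaussianPDF 0 1 z ≤
        ENNReal.ofReal (Real.exp (-(t ^ 2 / 2))) * gaussianReal 0 1 s := by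
    intro e s hs hpos he
    have het : e ^ 2 = t ^ 2 := by rw [← he, sq_abs]
    rw [gaussianReal_apply _ one_ne_zero, ← lintegral_indicator hs,
      ← lintegral_indicator (hs.preimage (by fun_prop)),
      ← lintegral_add_right_eq_self _ e,
      ← lintegral_const_mul _ ((measurable_gaussianPDF 0 1).indicator hs)]
    refine lintegral_mono fun z => ?_
    by_cases hz : z ∈ s
    · have hz' : z + e ∈ (fun z => z - e) ⁻¹' s := by simpa using hz
      rw [Set.indicator_of_mem hz', Set.indicator_of_mem hz, gaussianPDF, gaussianPDF,
        ← ENNReal.ofReal_mul (Real.exp_pos _).le]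
      refine ENNReal.ofReal_le_ofReal ?_
      rw [gaussianPDFReal, gaussianPDFReal, mul_left_comm, ← Real.exp_add]
      have := hpos z hz
      gcongr
      simp only [sub_zero, NNReal.coe_one]
      nlinarith
    · have hz' : z + e ∉ (fun z => z - e) ⁻¹' s := by simpa using hz
      rw [Set.indicator_of_notMem hz', Set.indicator_of_notMem hz]
      simp
  have hsub : {z : ℝ | t < |z|} ⊆
      (fun z => z - t) ⁻¹' Set.Ioi 0 ∪ (fun z => z - (-t)) ⁻¹' Set.Iio 0 := by
    intro z hz
    rcases lt_abs.1 (show t < |z| from hz) with h | h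
    · left; simpa using h
    · right; simp; linarith
  calc gaussianReal 0 1 {z | t < |z|}
      ≤ gaussianReal 0 1 ((fun z => z - t) ⁻¹' Set.Ioi 0)
        + gaussianReal 0 1 ((fun z => z - (-t)) ⁻¹' Set.Iio 0) :=
        (measure_mono hsub).trans (measure_union_le _ _)
    _ ≤ ENNReal.ofReal (Real.exp (-(t ^ 2 / 2))) * gaussianReal 0 1 (Set.Ioi 0)
        + ENNReal.ofReal (Real.exp (-(t ^ 2 / 2))) * gaussianReal 0 1 (Set.Iio 0) := by
        rw [gaussianReal_apply _ one_ne_zero, gaussianReal_apply _ one_ne_zero]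
        refine add_le_add (key t _ measurableSet_Ioi ?_ (abs_of_nonneg ht))
          (key (-t) _ measurableSet_Iio ?_ (by rw [abs_neg, abs_of_nonneg ht]))
        · intro z hz; exact mul_nonneg ht (le_of_lt hz)
        · intro z hz
          have : z < 0 := hz
          nlinarith
    _ = ENNReal.ofReal (Real.exp (-(t ^ 2 / 2))) *
        gaussianReal 0 1 (Set.Ioi 0 ∪ Set.Iio 0) := by
        rw [← mul_add, measure_union _ measurableSet_Iio]
        exact Set.disjoint_left.2 fun z h1 h2 => lt_asymm (Set.mem_Ioi.1 h1) (Set.mem_Iio.1 h2)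
    _ ≤ _ := mul_le_of_le_one_right zero_le prob_le_one

theorem exp_mul_sq_mul_gaussianPDFReal (a z : ℝ) :
    gaussianPDFReal 0 1 z * Real.exp (a * z ^ 2) =
      (√(2 * Real.pi))⁻¹ * Real.exp (-(1 / 2 - a) * z ^ 2) := by
  rw [gaussianPDFReal, mul_assoc, ← Real.exp_add]
  simp only [NNReal.coe_one, mul_one, sub_zero]
  congr 2
  ring

theorem integrable_exp_mul_sq_gaussianReal {a : ℝ} (ha : a < 1 / 2) :
    Integrable (fun z => Real.exp (a * z ^ 2)) (gaussianReal 0 1) := by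
  rw [gaussianReal_of_var_ne_zero _ one_ne_zero,
    integrable_withDensity_iff_integrable_smul' (measurable_gaussianPDF 0 1)
      (ae_of_all _ fun z => gaussianPDF_lt_top)]
  simp only [toReal_gaussianPDF, smul_eq_mul, exp_mul_sq_mul_gaussianPDFReal]
  exact (integrable_exp_neg_mul_sq (by linarith)).const_mul _

theorem integral_exp_mul_sq_gaussianReal {a : ℝ} (ha : a < 1 / 2) :
    ∫ z, Real.exp (a * z ^ 2) ∂(gaussianReal 0 1) = (√(1 - 2 * a))⁻¹ := by
  rw [integral_gaussianReal_eq_integral_smul one_ne_zero]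
  simp only [smul_eq_mul, exp_mul_sq_mul_gaussianPDFReal]
  have h : (0 : ℝ) < 1 / 2 - a := by linarith
  rw [integral_const_mul, integral_gaussian, ← Real.sqrt_inv, ← Real.sqrt_inv,
    ← Real.sqrt_mul (by positivity)]
  congr 1
  have : (1 - 2 * a) ≠ 0 := by linarith
  field_simp

/-! ### Exponential moments of Gaussian quadratic forms -/

section stdGaussian

variable {E : Type*} [NormedAddCommGroup E] [InnerProductSpace ℝ E] [FiniteDimensional ℝ E]

/-- An orthonormal basis adapted to a subspace and its orthogonal complement. -/
noncomputable def adaptedBasis (U : Submodule ℝ E) :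
    OrthonormalBasis (Fin (Module.finrank ℝ U) ⊕ Fin (Module.finrank ℝ Uᗮ)) ℝ E :=
  ((stdOrthonormalBasis ℝ U).prod (stdOrthonormalBasis ℝ Uᗮ)).map U.orthogonalDecomposition.symm

theorem adaptedBasis_inl (U : Submodule ℝ E) (i : Fin (Module.finrank ℝ U)) :
    adaptedBasis U (Sum.inl i) = stdOrthonormalBasis ℝ U i := by
  simp [adaptedBasis]

theorem norm_starProjection_sq_eq_sum (U : Submodule ℝ E) (g : E) :
    ‖U.starProjection g‖ ^ 2 = ∑ i, ⟪adaptedBasis U (Sum.inl i), g⟫ ^ 2 := by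
  rw [Submodule.starProjection_apply, Submodule.norm_coe,
    ← (stdOrthonormalBasis ℝ U).sum_sq_inner_right]
  refine Finset.sum_congr rfl fun i _ => ?_
  rw [adaptedBasis_inl, ← Submodule.inner_orthogonalProjectionOnto_eq_of_mem_left]

theorem inner_eq_sum_of_mem_orthogonal (U : Submodule ℝ E) {w : E} (hw : w ∈ Uᗮ) (g : E) :
    ⟪w, g⟫ = ∑ i, ⟪w, adaptedBasis U (Sum.inr i)⟫ * ⟪adaptedBasis U (Sum.inr i), g⟫ := by
  rw [← (adaptedBasis U).sum_inner_mul_inner, Fintype.sum_sum_type, Finset.sum_eq_zero, zero_add]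
  intro i _
  rw [adaptedBasis_inl, Submodule.inner_left_of_mem_orthogonal (Subtype.coe_prop _) hw, zero_mul]

variable [MeasurableSpace E] [BorelSpace E]

/-- In an orthonormal basis adapted to U and its complement, the quadratic part and the linear part
involve disjoint sets of independent standard coordinates, so the expectation factors into scalar
integrals. -/
theorem exp_gaussian_quadratic (U : Submodule ℝ E) {w : E} (hw : w ∈ Uᗮ) {a : ℝ}
    (ha : a < 1 / 2) :
    Integrable (fun g => Real.exp (a * ‖U.starProjection g‖ ^ 2 + ⟪w, g⟫)) (stdGaussian E) ∧
    ∫ g, Real.exp (a * ‖U.starProjection g‖ ^ 2 + ⟪w, g⟫) ∂(stdGaussian E) =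
      (√(1 - 2 * a))⁻¹ ^ Module.finrank ℝ U * Real.exp (‖w‖ ^ 2 / 2) := by
  set b := adaptedBasis U with hb
  let F : (Fin (Module.finrank ℝ U) ⊕ Fin (Module.finrank ℝ Uᗮ)) → ℝ → ℝ :=
    Sum.elim (fun _ z => Real.exp (a * z ^ 2)) (fun i z => Real.exp (⟪w, b (Sum.inr i)⟫ * z))
  have hF : ∀ z : (Fin (Module.finrank ℝ U) ⊕ Fin (Module.finrank ℝ Uᗮ)) → ℝ,
      Real.exp (a * ‖U.starProjection (∑ i, z i • b i)‖ ^ 2 + ⟪w, ∑ i, z i • b i⟫) =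
        ∏ i, F i (z i) := by
    intro z
    have hz : ∀ j, ⟪b j, ∑ i, z i • b i⟫ = z j := fun j => b.orthonormal.inner_right_fintype z j
    rw [norm_starProjection_sq_eq_sum, inner_eq_sum_of_mem_orthogonal U hw]
    simp only [← hb, hz, Fintype.prod_sum_type, F, Sum.elim_inl, Sum.elim_inr, ← Real.exp_sum,
      ← Real.exp_add, Finset.mul_sum]
  have hint : ∀ i, Integrable (F i) (gaussianReal 0 1) := by
    rintro (i | i)
    · exact integrable_exp_mul_sq_gaussianReal ha
    · exact integrable_exp_mul_gaussianReal _
  have hmap := stdGaussian_eq_map_pi_orthonormalBasis b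
  have hsum : Measurable (fun z : (Fin (Module.finrank ℝ U) ⊕ Fin (Module.finrank ℝ Uᗮ)) → ℝ =>
      ∑ i, z i • b i) := by fun_prop
  have hmeas : Measurable (fun g : E => Real.exp (a * ‖U.starProjection g‖ ^ 2 + ⟪w, g⟫)) := by
    fun_prop
  constructor
  · rw [hmap, integrable_map_measure hmeas.aestronglyMeasurable hsum.aemeasurable]
    refine (Integrable.fintype_prod hint).congr (ae_of_all _ fun z => (hF z).symm)
  · rw [hmap, integral_map hsum.aemeasurable hmeas.aestronglyMeasurable]
    simp only [hF]
    rw [integral_fintype_prod_eq_prod, Fintype.prod_sum_type]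
    simp only [F, Sum.elim_inl, Sum.elim_inr, integral_exp_mul_sq_gaussianReal ha]
    congr 1
    · simp
    · have hm : ∀ c : ℝ, ∫ z, Real.exp (c * z) ∂(gaussianReal 0 1) = Real.exp (c ^ 2 / 2) := by
        intro c
        have := congrFun (mgf_id_gaussianReal (μ := 0) (v := 1)) c
        simpa [mgf] using this
      simp only [hm, ← Real.exp_sum, ← Finset.sum_div]
      congr 2
      rw [← real_inner_self_eq_norm_sq, inner_eq_sum_of_mem_orthogonal U hw]
      exact Finset.sum_congr rfl fun i _ => by rw [sq, real_inner_comm w]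

end stdGaussian

/-! ### The prior weights on supports -/

section weights

variable {p : ℕ}

theorem exp_one_sub_one_pos : (0 : ℝ) < Real.exp 1 - 1 := by
  have := Real.exp_one_gt_d9
  linarith

theorem one_le_normConst (p : ℕ) : 1 ≤ normConst p := by
  rw [normConst, le_div_iff₀ exp_one_sub_one_pos]
  have : Real.exp (-(p : ℝ)) ≤ 1 := Real.exp_le_one_iff.2 (by simp)
  linarith

theorem log_normConst_le (p : ℕ) : Real.log (normConst p) ≤ 1 / 2 := by
  have hpos : 0 < normConst p := zero_lt_one.trans_le (one_le_normConst p)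
  have h1 := Real.exp_one_gt_d9
  have hle : normConst p ≤ 1.6 := by
    rw [normConst, div_le_iff₀ exp_one_sub_one_pos]
    have := Real.exp_pos (-(p : ℝ))
    linarith
  have h2 : Real.log (normConst p ^ 2) ≤ 1 := by
    rw [Real.log_le_iff_le_exp (by positivity)]
    nlinarith
  rw [Real.log_pow] at h2
  push_cast at h2
  linarith

theorem choose_card_pos (T : Finset (Fin p)) : 0 < (p.choose T.card : ℝ) := by
  have : T.card ≤ p := by simpa using T.card_le_univ
  exact_mod_cast Nat.choose_pos this

theorem weight_pos (T : Finset (Fin p)) : 0 < weight T := by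
  have := choose_card_pos T
  have := zero_lt_one.trans_le (one_le_normConst p)
  have := Real.exp_pos (T.card : ℝ)
  rw [weight]
  positivity

theorem log_one_div_weight (T : Finset (Fin p)) :
    Real.log (1 / weight T) =
      Real.log (normConst p) + Real.log (p.choose T.card) + T.card := by
  have h1 := choose_card_pos T
  have h2 := zero_lt_one.trans_le (one_le_normConst p)
  rw [weight, one_div, inv_inv, Real.log_mul (by positivity) (Real.exp_pos _).ne', Real.log_exp,
    Real.log_mul h2.ne' h1.ne']

theorem exp_neg_log_one_div_weight (T : Finset (Fin p)) :
    Real.exp (-Real.log (1 / weight T)) = weight T := by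
  rw [one_div, Real.log_inv, neg_neg, Real.exp_log (weight_pos T)]

theorem card_le_log_one_div_weight (T : Finset (Fin p)) :
    (T.card : ℝ) ≤ Real.log (1 / weight T) := by
  rw [log_one_div_weight]
  have h1 : 0 ≤ Real.log (normConst p) := Real.log_nonneg (one_le_normConst p)
  have h2 : 0 ≤ Real.log (p.choose T.card) := Real.log_natCast_nonneg _
  linarith

/-- Grouping by cardinality cancels the binomial coefficient and leaves the geometric sum of e^{-k}
for k ≤ p, which is H_p. -/
theorem sum_weight (p : ℕ) : ∑ T : Finset (Fin p), weight T = 1 := by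
  have hH := zero_lt_one.trans_le (one_le_normConst p)
  have h0 := exp_one_sub_one_pos
  rw [← Finset.powerset_univ, Finset.sum_powerset]
  simp only [Finset.card_univ, Fintype.card_fin]
  have h1 : ∀ k ∈ Finset.range (p + 1),
      ∑ T ∈ Finset.powersetCard k (Finset.univ : Finset (Fin p)), weight T =
        (normConst p)⁻¹ * Real.exp (-1) ^ k := by
    intro k hk
    have hk' : k ≤ p := Nat.lt_succ_iff.1 (Finset.mem_range.1 hk)
    have hc : (p.choose k : ℝ) ≠ 0 := by exact_mod_cast (Nat.choose_pos hk').ne'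
    rw [Finset.sum_congr rfl (g := fun _ =>
      (normConst p * (p.choose k : ℝ) * Real.exp (k : ℝ))⁻¹), Finset.sum_const,
      Finset.card_powersetCard, Finset.card_univ, Fintype.card_fin, nsmul_eq_mul,
      ← Real.exp_nat_mul, mul_neg_one, Real.exp_neg]
    · field_simp
    · intro T hT
      rw [weight, (Finset.mem_powersetCard.1 hT).2]
  have he : Real.exp (-1) ≠ 1 := by simp
  rw [Finset.sum_congr rfl h1, ← Finset.mul_sum, geom_sum_eq he, ← Real.exp_nat_mul, normConst]
  have h3 : Real.exp (-(p : ℝ)) = Real.exp 1 * Real.exp (((p + 1 : ℕ) : ℝ) * -1) := by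
    rw [← Real.exp_add]; congr 1; push_cast; ring
  have h4 : Real.exp (-1) = (Real.exp 1)⁻¹ := Real.exp_neg 1
  have h5 := Real.exp_pos 1
  rw [normConst, h3] at hH
  rw [h3, h4]
  generalize Real.exp (((p + 1 : ℕ) : ℝ) * -1) = q at *
  rw [div_pos_iff_of_pos_right h0] at hH
  have h6 : 1 - q ≠ 0 := by
    intro h
    nlinarith
  have h7 : Real.exp 1 - Real.exp 1 * q ≠ 0 := hH.ne'
  have h8 : 1 - Real.exp 1 ≠ 0 := by linarith
  have h9 : (Real.exp 1)⁻¹ - 1 = (1 - Real.exp 1) / Real.exp 1 := by field_simp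
  rw [h9]
  field_simp
  ring

/-- Serves to absorb the factor e^{|T|} of the weight into the |T|! gained from bounding the
binomial coefficient by p^{|T|}/|T|!. -/
theorem sub_log_factorial_le {p k : ℕ} (hp : 0 < p) (hk : k ≤ p) :
    (k : ℝ) - Real.log (k.factorial) ≤ 1 + 1 / 2 * Real.log p := by
  have hlog2 := Real.log_two_gt_d9
  -- The left side is largest at k = 2: from there each increment 1 - log(k + 1) is nonpositive,
  -- since 3 > e.
  have hmain : (k : ℝ) - Real.log (k.factorial) ≤ 2 - Real.log 2 := by
    induction k with
    | zero => simp; have := Real.log_two_lt_d9; linarith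
    | succ k ih =>
      have ih := ih (by omega)
      rcases Nat.lt_or_ge k 2 with h | h
      · interval_cases k
        · simp; have := Real.log_two_lt_d9; linarith
        · norm_num [Nat.factorial]
      · have hge : Real.log (k + 1 : ℝ) ≥ 1 := by
          rw [ge_iff_le, Real.le_log_iff_exp_le (by positivity)]
          have := Real.exp_one_lt_d9
          have : (2 : ℝ) ≤ k := by exact_mod_cast h
          linarith
        rw [Nat.factorial_succ, Nat.cast_mul, Real.log_mul (by positivity) (by positivity)]
        push_cast
        linarith
  rcases Nat.lt_or_ge p 2 with h | h
  · have : p = 1 := by omega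
    subst this
    interval_cases k <;> simp
  · have : Real.log 2 ≤ Real.log p := Real.log_le_log (by norm_num) (by exact_mod_cast h)
    linarith

theorem log_one_div_weight_le (hp : 0 < p) (T : Finset (Fin p)) :
    Real.log (1 / weight T) ≤ T.card * Real.log p + 3 / 2 + 1 / 2 * Real.log p := by
  have hT : T.card ≤ p := by simpa using T.card_le_univ
  rw [log_one_div_weight]
  have h1 := log_normConst_le p
  have h2 := sub_log_factorial_le hp hT
  have h3 : Real.log (p.choose T.card) ≤ T.card * Real.log p - Real.log (T.card.factorial) := by
    have hp' : (0 : ℝ) < p := by exact_mod_cast hp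
    rw [← Real.log_pow, ← Real.log_div (by positivity) (by positivity)]
    exact Real.log_le_log (choose_card_pos T) (Nat.choose_le_pow_div _ _)
  linarith

end weights

/-! ### Chernoff bounds for the standard Gaussian -/

section tails

variable {E : Type*} [NormedAddCommGroup E] [InnerProductSpace ℝ E] [FiniteDimensional ℝ E]
  [MeasurableSpace E] [BorelSpace E]

theorem stdGaussian_quadratic_tail (U : Submodule ℝ E) {w : E} (hw : w ∈ Uᗮ) {a c : ℝ}
    (ha : a < 1 / 2) (hc : (√(1 - 2 * a))⁻¹ ≤ Real.exp c) (u : ℝ) :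
    stdGaussian E {g | u + Module.finrank ℝ U * c <
      a * ‖U.starProjection g‖ ^ 2 + ⟪w, g⟫ - ‖w‖ ^ 2 / 2} ≤ ENNReal.ofReal (Real.exp (-u)) := by
  obtain ⟨hint, hval⟩ := exp_gaussian_quadratic U hw ha
  have hmarkov := measure_ge_le_exp_mul_mgf (μ := stdGaussian E)
    (X := fun g => a * ‖U.starProjection g‖ ^ 2 + ⟪w, g⟫) (t := 1)
    (u + Module.finrank ℝ U * c + ‖w‖ ^ 2 / 2) zero_le_one (by simpa using hint)
  simp only [mgf, one_mul] at hmarkov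
  rw [hval] at hmarkov
  have hb : Real.exp (-1 * (u + Module.finrank ℝ U * c + ‖w‖ ^ 2 / 2)) *
      ((√(1 - 2 * a))⁻¹ ^ Module.finrank ℝ U * Real.exp (‖w‖ ^ 2 / 2)) ≤ Real.exp (-u) := by
    calc _ ≤ Real.exp (-1 * (u + Module.finrank ℝ U * c + ‖w‖ ^ 2 / 2)) *
          (Real.exp c ^ Module.finrank ℝ U * Real.exp (‖w‖ ^ 2 / 2)) := by gcongr
      _ = Real.exp (-u) := by
        rw [← Real.exp_nat_mul, ← Real.exp_add, ← Real.exp_add]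
        congr 1
        ring
  rw [measureReal_def] at hmarkov
  rw [← ENNReal.ofReal_toReal (measure_ne_top (stdGaussian E) _)]
  refine ENNReal.ofReal_le_ofReal (le_trans ?_ (hmarkov.trans hb))
  refine ENNReal.toReal_mono (measure_ne_top _ _) (measure_mono fun g hg => ?_)
  have : u + Module.finrank ℝ U * c <
      a * ‖U.starProjection g‖ ^ 2 + ⟪w, g⟫ - ‖w‖ ^ 2 / 2 := hg
  rw [Set.mem_ofPred_eq]
  linarith

theorem stdGaussian_map_inner {v : E} (hv : ‖v‖ = 1) :
    (stdGaussian E).map (fun g => ⟪v, g⟫) = gaussianReal 0 1 := by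
  have h := IsGaussian.map_eq_gaussianReal (μ := stdGaussian E) (innerSL ℝ v)
  rw [integral_strongDual_stdGaussian, variance_dual_stdGaussian, innerSL_apply_norm, hv] at h
  simpa using h

theorem stdGaussian_abs_inner_gt_le {v : E} (hv : ‖v‖ = 1) {t : ℝ} (ht : 0 ≤ t) :
    stdGaussian E {g | t < |⟪v, g⟫|} ≤ ENNReal.ofReal (Real.exp (-(t ^ 2 / 2))) := by
  refine le_trans (le_of_eq ?_) (gaussianReal_abs_gt_le ht)
  rw [← stdGaussian_map_inner hv, Measure.map_apply (by fun_prop)]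
  · rfl
  · exact measurableSet_lt (by fun_prop) (by fun_prop)

end tails

/-! ### Uniform control of the noise -/

section events

variable {n p : ℕ}

theorem hasLaw_inv_smul {σ : ℝ} (hσ : 0 < σ)
    {Ω : Type*} [MeasurableSpace Ω] {P : Measure Ω} {ξ : Ω → EuclideanSpace ℝ (Fin n)}
    (hξ : HasLaw ξ (multivariateGaussian 0 (σ ^ 2 • (1 : Matrix (Fin n) (Fin n) ℝ))) P) :
    HasLaw (fun ω => σ⁻¹ • ξ ω) (stdGaussian (EuclideanSpace ℝ (Fin n))) P := by
  have hmap : HasLaw (fun v => σ⁻¹ • v) (stdGaussian (EuclideanSpace ℝ (Fin n)))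
      (multivariateGaussian 0 (σ ^ 2 • (1 : Matrix (Fin n) (Fin n) ℝ))) := by
    refine ⟨by fun_prop, Measure.ext_of_charFun ?_⟩
    ext t
    have hS : (σ ^ 2 • (1 : Matrix (Fin n) (Fin n) ℝ)).PosSemidef :=
      Matrix.PosSemidef.one.smul (by positivity)
    rw [charFun_map_smul, charFun_multivariateGaussian hS, charFun_stdGaussian]
    congr 1
    simp only [inner_zero_right, Complex.ofReal_zero, zero_mul, zero_sub, neg_div, neg_inj,
      Matrix.smul_mulVec, Matrix.one_mulVec]
    congr 1
    rw [← Complex.ofReal_pow]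
    congr 1
    rw [EuclideanSpace.real_norm_sq_eq, dotProduct]
    refine Finset.sum_congr rfl fun i _ => ?_
    simp
    field_simp
  exact hmap.comp hξ

/-- Since the weights sum to one, a level log(1/π_T) + x for each T makes the union over all
supports cost nothing beyond e^{-x}. -/
theorem measure_exists_support_le {E : Type*} [MeasurableSpace E] (γ : Measure E) (x : ℝ)
    (A : Finset (Fin p) → Set E)
    (hA : ∀ T, γ (A T) ≤ ENNReal.ofReal (Real.exp (-(Real.log (1 / weight T) + x)))) :
    γ (⋃ T, A T) ≤ ENNReal.ofReal (Real.exp (-x)) := by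
  calc γ (⋃ T, A T) ≤ ∑ T, γ (A T) := measure_iUnion_fintype_le _ _
    _ ≤ ∑ T : Finset (Fin p), ENNReal.ofReal (weight T * Real.exp (-x)) := by
      refine Finset.sum_le_sum fun T _ => (hA T).trans (le_of_eq ?_)
      rw [neg_add, Real.exp_add, exp_neg_log_one_div_weight]
    _ = ENNReal.ofReal (Real.exp (-x)) := by
      rw [← ENNReal.ofReal_sum_of_nonneg, ← Finset.sum_mul, sum_weight, one_mul]
      exact fun T _ => mul_nonneg (weight_pos T).le (Real.exp_pos _).le

/-- The span of the columns of `X` with index in `T`. -/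
def colSpan (X : Matrix (Fin n) (Fin p) ℝ) (T : Finset (Fin p)) :
    Submodule ℝ (EuclideanSpace ℝ (Fin n)) :=
  Submodule.span ℝ (column X '' (T : Set (Fin p)))

theorem proj_eq (X : Matrix (Fin n) (Fin p) ℝ) (T : Finset (Fin p))
    (v : EuclideanSpace ℝ (Fin n)) : proj X T v = (colSpan X T).starProjection v := rfl

theorem finrank_colSpan_le (X : Matrix (Fin n) (Fin p) ℝ) (T : Finset (Fin p)) :
    Module.finrank ℝ (colSpan X T) ≤ T.card := by
  classical
  have : (column X '' (T : Set (Fin p))) = ((T.image (column X) : Finset _) : Set _) := by simp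
  rw [colSpan, this]
  exact (finrank_span_finset_le_card _).trans Finset.card_image_le

theorem proj_sub_mem_orthogonal (X : Matrix (Fin n) (Fin p) ℝ) (T : Finset (Fin p))
    (v : EuclideanSpace ℝ (Fin n)) : proj X T v - v ∈ (colSpan X T)ᗮ := by
  rw [proj_eq, ← neg_sub]
  exact neg_mem (Submodule.sub_starProjection_mem_orthogonal _)

theorem stdGaussian_quadratic_event (X : Matrix (Fin n) (Fin p) ℝ)
    (f : EuclideanSpace ℝ (Fin n)) (x : ℝ) :
    stdGaussian (EuclideanSpace ℝ (Fin n))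
      (⋃ T, {g | 26 * Real.log (1 / weight T) + 20 * x <
        19 / 10 * ‖proj X T g‖ ^ 2 + 2 * ⟪proj X T f - f, g⟫
          - 1 / 10 * ‖proj X T f - f‖ ^ 2}) ≤ ENNReal.ofReal (Real.exp (-x)) := by
  refine measure_exists_support_le _ x _ fun T => ?_
  -- The inequality is scaled by 1/20, which makes the last term exactly ‖w‖²/2. Here √(1 - 2a) =
  -- 9/10 and 10/9 ≤ e^{3/10}. The dimension is at most log(1/π_T), so the level is at most 1.3
  -- log(1/π_T) + x; multiplying by 20 gives the constant 26 of the criterion.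
  refine le_trans (measure_mono fun g hg => ?_) (stdGaussian_quadratic_tail (colSpan X T)
    (w := (1 / 10 : ℝ) • (proj X T f - f)) (a := 19 / 200) (c := 3 / 10)
    (Submodule.smul_mem _ _ (proj_sub_mem_orthogonal X T f)) (by norm_num) ?_
    (Real.log (1 / weight T) + x))
  · have hg' : 26 * Real.log (1 / weight T) + 20 * x <
        19 / 10 * ‖proj X T g‖ ^ 2 + 2 * ⟪proj X T f - f, g⟫
          - 1 / 10 * ‖proj X T f - f‖ ^ 2 := hg
    have h1 := card_le_log_one_div_weight T
    have h2 : (Module.finrank ℝ (colSpan X T) : ℝ) ≤ T.card := by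
      exact_mod_cast finrank_colSpan_le X T
    rw [Set.mem_ofPred_eq]
    rw [real_inner_smul_left, norm_smul, mul_pow, ← proj_eq]
    norm_num
    norm_num at hg' h1
    linarith
  · have h : (1 - 2 * (19 / 200) : ℝ) = (9 / 10) ^ 2 := by norm_num
    rw [h, Real.sqrt_sq (by norm_num)]
    have := Real.add_one_le_exp (3 / 10 : ℝ)
    norm_num at this ⊢
    linarith

theorem stdGaussian_proj_event (X : Matrix (Fin n) (Fin p) ℝ) {x : ℝ} (hx : 0 ≤ x) :
    stdGaussian (EuclideanSpace ℝ (Fin n))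
      (⋃ T, {g | 6 * Real.log (1 / weight T) + 4 * x < ‖proj X T g‖ ^ 2}) ≤
        ENNReal.ofReal (Real.exp (-x)) := by
  refine measure_exists_support_le _ x _ fun T => ?_
  -- Here √(1 - 2a) = 1/2 and 2 ≤ e^{5/4}; the level (9/4) log(1/π_T) + x times 8/3 is at most 6
  -- log(1/π_T) + 4x.
  refine le_trans (measure_mono fun g hg => ?_) (stdGaussian_quadratic_tail (colSpan X T)
    (w := 0) (a := 3 / 8) (c := 5 / 4) (Submodule.zero_mem _) (by norm_num) ?_
    (Real.log (1 / weight T) + x))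
  · have hg' : 6 * Real.log (1 / weight T) + 4 * x < ‖proj X T g‖ ^ 2 := hg
    have h1 := card_le_log_one_div_weight T
    have h2 : (Module.finrank ℝ (colSpan X T) : ℝ) ≤ T.card := by
      exact_mod_cast finrank_colSpan_le X T
    rw [Set.mem_ofPred_eq]
    rw [← proj_eq, inner_zero_left, norm_zero]
    linarith
  · have h : (1 - 2 * (3 / 8) : ℝ) = (1 / 2) ^ 2 := by norm_num
    rw [h, Real.sqrt_sq (by norm_num)]
    have := Real.add_one_le_exp (5 / 4 : ℝ)
    norm_num at this ⊢
    linarith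

theorem norm_column_sq (hn : 0 < n) {X : Matrix (Fin n) (Fin p) ℝ} (j : Fin p) :
    ‖column X j‖ ^ 2 = n * gram X j j := by
  have : (n : ℝ) ≠ 0 := by positivity
  rw [EuclideanSpace.real_norm_sq_eq, gram, Matrix.smul_apply, Matrix.mul_apply, smul_eq_mul,
    ← mul_assoc, mul_one_div_cancel this, one_mul]
  exact Finset.sum_congr rfl fun i _ => by simp [column, sq]

theorem stdGaussian_noise_event (hn : 0 < n) (hp : 0 < p) {X : Matrix (Fin n) (Fin p) ℝ}
    (hX : ∀ j, gram X j j = 1) {x : ℝ} (hx : 0 ≤ x) :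
    stdGaussian (EuclideanSpace ℝ (Fin n))
      (⋃ j, {g | √n * √(2 * (Real.log p + x)) < |⟪column X j, g⟫|}) ≤
        ENNReal.ofReal (Real.exp (-x)) := by
  have hn' : (0 : ℝ) < √n := by positivity
  have hp' : (0 : ℝ) < p := by exact_mod_cast hp
  have hlog : 0 ≤ Real.log p := Real.log_natCast_nonneg _
  have hcol : ∀ j, ‖column X j‖ = √n := fun j => by
    rw [← Real.sqrt_sq (norm_nonneg _), norm_column_sq hn, hX, mul_one]
  have hj : ∀ j, stdGaussian (EuclideanSpace ℝ (Fin n))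
      {g | √n * √(2 * (Real.log p + x)) < |⟪column X j, g⟫|} ≤
        ENNReal.ofReal ((p : ℝ)⁻¹ * Real.exp (-x)) := by
    intro j
    have hu : ‖(√n)⁻¹ • column X j‖ = 1 := by
      rw [norm_smul, hcol, norm_inv, Real.norm_of_nonneg hn'.le, inv_mul_cancel₀ hn'.ne']
    refine le_trans (measure_mono fun g hg => ?_)
      ((stdGaussian_abs_inner_gt_le hu (Real.sqrt_nonneg (2 * (Real.log p + x)))).trans
        (ENNReal.ofReal_le_ofReal (le_of_eq ?_)))
    · rw [Set.mem_ofPred_eq]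
      rw [real_inner_smul_left, abs_mul, abs_of_pos (inv_pos.2 hn'), lt_inv_mul_iff₀ hn']
      exact hg
    · rw [Real.sq_sqrt (by positivity), mul_div_cancel_left₀ _ two_ne_zero, neg_add, Real.exp_add,
        Real.exp_neg, Real.exp_log hp']
  calc _ ≤ ∑ j, _ := measure_iUnion_fintype_le _ _
    _ ≤ ∑ j : Fin p, ENNReal.ofReal ((p : ℝ)⁻¹ * Real.exp (-x)) :=
      Finset.sum_le_sum fun j _ => hj j
    _ = _ := by
      rw [← ENNReal.ofReal_sum_of_nonneg (fun _ _ => by positivity)]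
      rw [Finset.sum_const, Finset.card_univ, Fintype.card_fin, nsmul_eq_mul,
        mul_inv_cancel_left₀ hp'.ne']

end events

/-! ### Convexity on the simplex -/

section Aggregation

variable {E ι : Type*} [NormedAddCommGroup E] [InnerProductSpace ℝ E]

theorem sum_mul_norm_sub_sq (F : Finset ι) (θ : ι → ℝ) (hθ : ∑ i ∈ F, θ i = 1) (m : ι → E)
    (z : E) :
    ∑ i ∈ F, θ i * ‖m i - z‖ ^ 2 = ‖(∑ i ∈ F, θ i • m i) - z‖ ^ 2
      + ∑ i ∈ F, θ i * ‖m i - ∑ i ∈ F, θ i • m i‖ ^ 2 := by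
  set μ := ∑ i ∈ F, θ i • m i with hμ
  have h0 : ∑ i ∈ F, θ i * ⟪m i - μ, μ - z⟫ = 0 := by
    have : ∑ i ∈ F, θ i • (m i - μ) = 0 := by
      simp only [smul_sub, Finset.sum_sub_distrib, ← Finset.sum_smul, hθ, one_smul, ← hμ, sub_self]
    simp only [← real_inner_smul_left, ← sum_inner, this, inner_zero_left]
  have h1 : ∀ i ∈ F, θ i * ‖m i - z‖ ^ 2 =
      θ i * ‖μ - z‖ ^ 2 + θ i * ‖m i - μ‖ ^ 2 + 2 * (θ i * ⟪m i - μ, μ - z⟫) := by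
    intro i _
    rw [← sub_add_sub_cancel (m i) μ z, norm_add_sq_real]
    ring
  rw [Finset.sum_congr rfl h1, Finset.sum_add_distrib, Finset.sum_add_distrib, ← Finset.mul_sum,
    h0, ← Finset.sum_mul, hθ]
  ring

theorem norm_one_sub_smul_add_smul_sq (t : ℝ) (u v : E) :
    ‖(1 - t) • u + t • v‖ ^ 2 =
      (1 - t) * ‖u‖ ^ 2 + t * ‖v‖ ^ 2 - t * (1 - t) * ‖u - v‖ ^ 2 := by
  rw [norm_add_sq_real, norm_sub_sq_real, norm_smul, norm_smul, mul_pow, mul_pow,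
    real_inner_smul_left, real_inner_smul_right]
  simp only [Real.norm_eq_abs, sq_abs]
  ring

/-- Lets the step along a segment tend to zero once t has been divided out. It replaces
differentiation at a minimizer, both for the aggregate and for the nonsmooth Lasso objective. -/
theorem le_of_forall_mul_one_sub_le {A B : ℝ}
    (h : ∀ t, 0 < t → t ≤ 1 → (1 - t) * A ≤ B) : A ≤ B := by
  have h1 : Filter.Tendsto (fun t : ℝ => (1 - t) * A) (nhdsWithin 0 (Set.Ioi 0))
      (nhds ((1 - 0) * A)) := by
    apply Filter.Tendsto.mono_left _ nhdsWithin_le_nhds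
    exact (Continuous.tendsto (by fun_prop) 0)
  rw [sub_zero, one_mul] at h1
  refine le_of_tendsto h1 ?_
  filter_upwards [Ioc_mem_nhdsGT (zero_lt_one' ℝ)] with t ht
  exact h t ht.1 ht.2

theorem sum_segment_smul [DecidableEq ι] {M : Type*} [AddCommGroup M] [Module ℝ M]
    (F : Finset ι) (θ : ι → ℝ) (t : ℝ) {k : ι} (hk : k ∈ F) (g : ι → M) :
    ∑ i ∈ F, ((1 - t) * θ i + t * (if i = k then 1 else 0)) • g i =
      (1 - t) • (∑ i ∈ F, θ i • g i) + t • g k := by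
  simp only [add_smul, mul_smul, Finset.sum_add_distrib, ← Finset.smul_sum, ite_smul, one_smul,
    zero_smul, Finset.sum_ite_eq', if_pos hk]

/-- First-order optimality of a minimizer of a strongly convex quadratic over the simplex. -/
theorem simplex_minimizer_optimality [DecidableEq ι] (F : Finset ι) (m : ι → E) (y : E) (c : ι → ℝ)
    {θ : ι → ℝ} (hθ1 : ∑ i ∈ F, θ i = 1) (hθ0 : ∀ i ∈ F, 0 ≤ θ i)
    (hmin : ∀ θ' : ι → ℝ, ∑ i ∈ F, θ' i = 1 → (∀ i ∈ F, 0 ≤ θ' i) →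
      1 / 2 * ‖(∑ i ∈ F, θ i • m i) - y‖ ^ 2 + ∑ i ∈ F, θ i * c i ≤
        1 / 2 * ‖(∑ i ∈ F, θ' i • m i) - y‖ ^ 2 + ∑ i ∈ F, θ' i * c i)
    {k : ι} (hk : k ∈ F) :
    1 / 2 * ‖(∑ i ∈ F, θ i • m i) - y‖ ^ 2 + 1 / 2 * ‖(∑ i ∈ F, θ i • m i) - m k‖ ^ 2
      + ∑ i ∈ F, θ i * c i ≤ 1 / 2 * ‖m k - y‖ ^ 2 + c k := by
  set μ := ∑ i ∈ F, θ i • m i with hμ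
  suffices h : 1 / 2 * ‖μ - m k‖ ^ 2 ≤
      1 / 2 * ‖m k - y‖ ^ 2 + c k - 1 / 2 * ‖μ - y‖ ^ 2 - ∑ i ∈ F, θ i * c i by linarith
  refine le_of_forall_mul_one_sub_le fun t ht0 ht1 => ?_
  have h := hmin (fun i => (1 - t) * θ i + t * (if i = k then 1 else 0)) ?_ ?_
  · have h2 := sum_segment_smul F θ t hk c
    simp only [smul_eq_mul] at h2
    rw [h2, sum_segment_smul F θ t hk m, ← hμ,
      show (1 - t) • μ + t • m k - y = (1 - t) • (μ - y) + t • (m k - y) by module,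
      norm_one_sub_smul_add_smul_sq, sub_sub_sub_cancel_right] at h
    have h3 : 0 ≤ t * (1 / 2 * ‖m k - y‖ ^ 2 + c k - 1 / 2 * ‖μ - y‖ ^ 2 - ∑ i ∈ F, θ i * c i
        - (1 - t) * (1 / 2 * ‖μ - m k‖ ^ 2)) := by linarith
    have h4 := nonneg_of_mul_nonneg_right h3 ht0
    linarith
  · have := sum_segment_smul F θ t hk (fun _ => (1 : ℝ))
    simp only [smul_eq_mul, mul_one] at this
    rw [this, hθ1]
    ring
  · intro i hi
    have := hθ0 i hi
    have : 0 ≤ 1 - t := by linarith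
    split_ifs <;> positivity

end Aggregation

/-! ### Oracle inequality for Q-aggregation -/

section QAggregate

variable {n p : ℕ}

theorem inner_proj_sub_self (X : Matrix (Fin n) (Fin p) ℝ) (T : Finset (Fin p))
    (u v : EuclideanSpace ℝ (Fin n)) : ⟪proj X T u, proj X T v - v⟫ = 0 :=
  Submodule.inner_right_of_mem_orthogonal (Submodule.starProjection_apply_mem _ _)
    (proj_sub_mem_orthogonal X T v)

theorem proj_add (X : Matrix (Fin n) (Fin p) ℝ) (T : Finset (Fin p))
    (u v : EuclideanSpace ℝ (Fin n)) : proj X T (u + v) = proj X T u + proj X T v := by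
  simp [proj]

theorem proj_smul (X : Matrix (Fin n) (Fin p) ℝ) (T : Finset (Fin p)) (c : ℝ)
    (u : EuclideanSpace ℝ (Fin n)) : proj X T (c • u) = c • proj X T u := by
  simp [proj]

theorem norm_proj_add_sub_sq (X : Matrix (Fin n) (Fin p) ℝ) (T : Finset (Fin p))
    (f ξ : EuclideanSpace ℝ (Fin n)) :
    ‖proj X T (f + ξ) - f‖ ^ 2 = ‖proj X T f - f‖ ^ 2 + ‖proj X T ξ‖ ^ 2 := by
  rw [proj_add, add_sub_right_comm, norm_add_sq_real, real_inner_comm, inner_proj_sub_self]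
  ring

theorem inner_proj_self (X : Matrix (Fin n) (Fin p) ℝ) (T : Finset (Fin p))
    (ξ : EuclideanSpace ℝ (Fin n)) : ⟪proj X T ξ, ξ⟫ = ‖proj X T ξ‖ ^ 2 := by
  have := inner_proj_sub_self X T ξ ξ
  rw [inner_sub_right, real_inner_self_eq_norm_sq] at this
  linarith

/-- The bias-variance identity trades half of the fit term and the dispersion penalty for a term
linear in θ, which exposes the quadratic form needed for the optimality inequality. -/
theorem qCrit_eq (X : Matrix (Fin n) (Fin p) ℝ) (F : Finset (Finset (Fin p))) (v : ℝ)
    (y : EuclideanSpace ℝ (Fin n)) {θ : Finset (Fin p) → ℝ} (hθ : ∑ T ∈ F, θ T = 1) :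
    qCrit X F v y θ = 1 / 2 * ‖(∑ T ∈ F, θ T • proj X T y) - y‖ ^ 2
      + ∑ T ∈ F, θ T * (1 / 2 * ‖proj X T y - y‖ ^ 2 + 26 * v * Real.log (1 / weight T)) := by
  have h := sum_mul_norm_sub_sq F θ hθ (fun T => proj X T y) y
  have h1 : ∑ T ∈ F, θ T * (1 / 2 * ‖proj X T y - y‖ ^ 2 + 26 * v * Real.log (1 / weight T)) =
      1 / 2 * ∑ T ∈ F, θ T * ‖proj X T y - y‖ ^ 2
        + 26 * v * ∑ T ∈ F, θ T * Real.log (1 / weight T) := by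
    rw [Finset.mul_sum, Finset.mul_sum, ← Finset.sum_add_distrib]
    exact Finset.sum_congr rfl fun T _ => by ring
  rw [h1, h, qCrit]
  simp only [mix]
  ring

/-- Oracle inequality for the Q-aggregate on the event where the noise is controlled. -/
theorem norm_qAggregate_sub_sq_le (X : Matrix (Fin n) (Fin p) ℝ) {F : Finset (Finset (Fin p))}
    {v C : ℝ} {f ξ m : EuclideanSpace ℝ (Fin n)} (hm : IsQAggregate X F v (f + ξ) m)
    (hQ : ∀ S, 19 / 10 * ‖proj X S ξ‖ ^ 2 + 2 * ⟪proj X S f - f, ξ⟫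
      - 1 / 10 * ‖proj X S f - f‖ ^ 2 ≤ 26 * v * Real.log (1 / weight S) + C)
    {T : Finset (Fin p)} (hT : T ∈ F) :
    ‖m - f‖ ^ 2 ≤ ‖proj X T (f + ξ) - (f + ξ)‖ ^ 2 - ‖ξ‖ ^ 2
      + 1 / 8 * (‖proj X T f - f‖ ^ 2 + ‖proj X T ξ‖ ^ 2)
      + 26 * v * Real.log (1 / weight T) + C := by
  obtain ⟨θ, ⟨hθ1, hθ0⟩, hmin, rfl⟩ := hm
  have hopt := simplex_minimizer_optimality F (fun T => proj X T (f + ξ)) (f + ξ)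
    (fun T => 1 / 2 * ‖proj X T (f + ξ) - (f + ξ)‖ ^ 2 + 26 * v * Real.log (1 / weight T))
    hθ1 hθ0 (fun θ' h1 h0 => by
      rw [← qCrit_eq X F v _ hθ1, ← qCrit_eq X F v _ h1]
      exact hmin θ' ⟨h1, h0⟩) hT
  have hy : ∀ u : EuclideanSpace ℝ (Fin n),
      ‖u - (f + ξ)‖ ^ 2 = ‖u - f‖ ^ 2 - 2 * ⟪u - f, ξ⟫ + ‖ξ‖ ^ 2 := fun u => by
    rw [← sub_sub, norm_sub_sq_real]
  rw [← norm_proj_add_sub_sq]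
  -- A tenth of the squared loss of each projection estimator is given up to pay for twice its noise
  -- correlation. The coefficient 19/10 in `hQ` is 2 - 1/10, as ‖Π_S ξ‖² occurs in both.
  have hS : ∀ S ∈ F, θ S * (2 / 5 * ‖proj X S (f + ξ) - f‖ ^ 2 + ⟪proj X S (f + ξ) - f, ξ⟫
      + 1 / 2 * ‖ξ‖ ^ 2 - C) ≤ θ S * (1 / 2 * ‖proj X S (f + ξ) - (f + ξ)‖ ^ 2
        + 26 * v * Real.log (1 / weight S)) := by
    intro S hS
    refine mul_le_mul_of_nonneg_left ?_ (hθ0 S hS)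
    have h1 := hQ S
    have h2 : ⟪proj X S (f + ξ) - f, ξ⟫ = ⟪proj X S f - f, ξ⟫ + ‖proj X S ξ‖ ^ 2 := by
      rw [proj_add, add_sub_right_comm, inner_add_left, inner_proj_self]
    rw [hy, h2, norm_proj_add_sub_sq]
    linarith
  have hsum := Finset.sum_le_sum hS
  have hexp : ∑ S ∈ F, θ S * (2 / 5 * ‖proj X S (f + ξ) - f‖ ^ 2 + ⟪proj X S (f + ξ) - f, ξ⟫
      + 1 / 2 * ‖ξ‖ ^ 2 - C) = 2 / 5 * (∑ S ∈ F, θ S * ‖proj X S (f + ξ) - f‖ ^ 2)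
        + ⟪mix X F (f + ξ) θ - f, ξ⟫ + 1 / 2 * ‖ξ‖ ^ 2 - C := by
    have h1 : mix X F (f + ξ) θ - f = ∑ S ∈ F, θ S • (proj X S (f + ξ) - f) := by
      simp only [mix, smul_sub, Finset.sum_sub_distrib, ← Finset.sum_smul, hθ1, one_smul]
    rw [h1, sum_inner]
    simp only [real_inner_smul_left, mul_add, mul_sub, Finset.sum_add_distrib,
      Finset.sum_sub_distrib, ← Finset.sum_mul, hθ1, one_mul, Finset.mul_sum]
    refine congrArg₂ _ (congrArg₂ _ (congrArg₂ _ (Finset.sum_congr rfl fun S _ => ?_) rfl) rfl) rfl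
    ring
  have hjensen : ‖mix X F (f + ξ) θ - f‖ ^ 2 ≤
      ∑ S ∈ F, θ S * ‖proj X S (f + ξ) - f‖ ^ 2 := by
    rw [sum_mul_norm_sub_sq F θ hθ1]
    have : 0 ≤ ∑ S ∈ F, θ S * ‖proj X S (f + ξ) - ∑ S ∈ F, θ S • proj X S (f + ξ)‖ ^ 2 :=
      Finset.sum_nonneg fun S hS => mul_nonneg (hθ0 S hS) (by positivity)
    simp only [mix]
    linarith
  rw [hexp] at hsum
  change 1 / 2 * ‖mix X F (f + ξ) θ - (f + ξ)‖ ^ 2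
    + 1 / 2 * ‖mix X F (f + ξ) θ - proj X T (f + ξ)‖ ^ 2 + _ ≤ _ at hopt
  have h5 := hy (mix X F (f + ξ) θ)
  have h6 : ‖mix X F (f + ξ) θ - proj X T (f + ξ)‖ ^ 2 = ‖mix X F (f + ξ) θ - f‖ ^ 2
      - 2 * ⟪mix X F (f + ξ) θ - f, proj X T (f + ξ) - f⟫ + ‖proj X T (f + ξ) - f‖ ^ 2 := by
    rw [← norm_sub_sq_real, sub_sub_sub_cancel_right]
  have h7 := real_inner_le_norm (mix X F (f + ξ) θ - f) (proj X T (f + ξ) - f)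
  -- After the noise correlation of the mixture cancels, 9/10 of its loss and half its squared
  -- distance to Π_T y remain. This square recovers the full loss at the price of 1/8 of the loss of
  -- Π_T y.
  have h8 := sq_nonneg (4 * ‖mix X F (f + ξ) θ - f‖ - 5 * ‖proj X T (f + ξ) - f‖)
  have h9 : ‖mix X F (f + ξ) θ - f‖ ^ 2 - 1 / 8 * ‖proj X T (f + ξ) - f‖ ^ 2 ≤
      9 / 10 * ‖mix X F (f + ξ) θ - f‖ ^ 2
        + 1 / 2 * ‖mix X F (f + ξ) θ - proj X T (f + ξ)‖ ^ 2 := by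
    rw [h6]
    nlinarith
  linarith

end QAggregate

/-! ### Optimality conditions for the Lasso -/

section Lasso

variable {n p : ℕ}

theorem fit_eq_sum (X : Matrix (Fin n) (Fin p) ℝ) (β : Fin p → ℝ) :
    fit X β = ∑ j, β j • column X j := by
  ext i
  simp [fit, column, Matrix.mulVec, dotProduct, mul_comm]

theorem fit_sub (X : Matrix (Fin n) (Fin p) ℝ) (β β' : Fin p → ℝ) :
    fit X (β - β') = fit X β - fit X β' := by
  simp [fit_eq_sum, sub_smul, Finset.sum_sub_distrib]

theorem fit_single (X : Matrix (Fin n) (Fin p) ℝ) (j : Fin p) (c : ℝ) :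
    fit X (Pi.single j c) = c • column X j := by
  rw [fit_eq_sum, Finset.sum_eq_single j]
  · simp
  · intro i _ hi; simp [hi]
  · simp

theorem fit_mem_colSpan_supp (X : Matrix (Fin n) (Fin p) ℝ) (β : Fin p → ℝ) :
    fit X β ∈ colSpan X (supp β) := by
  rw [fit_eq_sum]
  refine Submodule.sum_mem _ fun j _ => ?_
  by_cases hj : β j = 0
  · simp [hj]
  · exact Submodule.smul_mem _ _ (Submodule.subset_span ⟨j, by simp [supp, hj], rfl⟩)

theorem norm_proj_sub_le (X : Matrix (Fin n) (Fin p) ℝ) {T : Finset (Fin p)}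
    {u : EuclideanSpace ℝ (Fin n)} (hu : u ∈ colSpan X T) (v : EuclideanSpace ℝ (Fin n)) :
    ‖proj X T v - v‖ ≤ ‖u - v‖ := by
  rw [norm_sub_rev, proj_eq, norm_sub_rev u, Submodule.starProjection_minimal]
  exact ciInf_le ⟨0, by rintro _ ⟨w, rfl⟩; positivity⟩ (⟨u, hu⟩ : colSpan X T)

/-- Variational inequality satisfied by a Lasso solution. -/
theorem IsLasso.inner_le (hn : 0 < n) {X : Matrix (Fin n) (Fin p) ℝ}
    {y : EuclideanSpace ℝ (Fin n)} {lam : ℝ} (hlam : 0 ≤ lam) {β : Fin p → ℝ}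
    (h : IsLasso X y lam β) (β' : Fin p → ℝ) :
    ⟪y - fit X β, fit X β' - fit X β⟫ ≤ n * lam * (∑ j, |β' j| - ∑ j, |β j|) := by
  have hn' : (0 : ℝ) < n := by exact_mod_cast hn
  suffices hs : ‖fit X β' - fit X β‖ ^ 2 ≤ ‖fit X β' - fit X β‖ ^ 2
      - 2 * ⟪y - fit X β, fit X β' - fit X β⟫ + 2 * (n * lam * (∑ j, |β' j| - ∑ j, |β j|)) by
    linarith
  refine le_of_forall_mul_one_sub_le fun t ht0 ht1 => ?_
  have hle := h (β + t • (β' - β))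
  have hfit : fit X (β + t • (β' - β)) = fit X β + t • (fit X β' - fit X β) := by
    simp only [fit_eq_sum, Pi.add_apply, Pi.smul_apply, Pi.sub_apply, smul_eq_mul, add_smul,
      Finset.sum_add_distrib, mul_smul, ← Finset.smul_sum, sub_smul, Finset.sum_sub_distrib]
  have habs : ∑ j, |(β + t • (β' - β)) j| ≤ (1 - t) * ∑ j, |β j| + t * ∑ j, |β' j| := by
    rw [Finset.mul_sum, Finset.mul_sum, ← Finset.sum_add_distrib]
    refine Finset.sum_le_sum fun j _ => ?_
    have h1 : (β + t • (β' - β)) j = (1 - t) * β j + t * β' j := by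
      simp only [Pi.add_apply, Pi.smul_apply, Pi.sub_apply, smul_eq_mul]; ring
    rw [h1]
    refine (abs_add_le _ _).trans (le_of_eq ?_)
    rw [abs_mul, abs_mul, abs_of_nonneg (by linarith : 0 ≤ 1 - t), abs_of_pos ht0]
  simp only [lassoObj] at hle
  rw [hfit, ← sub_sub, norm_sub_sq_real (y - fit X β), norm_smul, mul_pow, real_inner_smul_right,
    Real.norm_eq_abs, sq_abs] at hle
  have h2 := mul_le_mul_of_nonneg_left habs hlam
  set A := ‖y - fit X β‖ ^ 2
  set I := ⟪y - fit X β, fit X β' - fit X β⟫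
  set D := ‖fit X β' - fit X β‖ ^ 2
  have h3 : 1 / (2 * (n : ℝ)) * (A - 2 * (t * I) + t ^ 2 * D) - 1 / (2 * (n : ℝ)) * A
      = t * (1 / (2 * (n : ℝ)) * (t * D - 2 * I)) := by ring
  have h4 : 0 ≤ t * (1 / (2 * (n : ℝ)) * (t * D - 2 * I)
      + lam * (∑ j, |β' j| - ∑ j, |β j|)) := by linarith
  have h5 := nonneg_of_mul_nonneg_right h4 ht0
  have h6 : 0 ≤ 2 * (n : ℝ) * (1 / (2 * (n : ℝ)) * (t * D - 2 * I)
      + lam * (∑ j, |β' j| - ∑ j, |β j|)) := by positivity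
  rw [mul_add, ← mul_assoc, mul_one_div_cancel (by positivity), one_mul] at h6
  linarith

/-- Setting the active coordinate to zero in the variational inequality isolates one column: this is
the half of the stationarity conditions that limits the size of the support. -/
theorem IsLasso.le_abs_inner_column (hn : 0 < n) {X : Matrix (Fin n) (Fin p) ℝ}
    {y : EuclideanSpace ℝ (Fin n)} {lam : ℝ} (hlam : 0 ≤ lam) {β : Fin p → ℝ}
    (h : IsLasso X y lam β) {j : Fin p} (hj : β j ≠ 0) :
    n * lam ≤ |⟪column X j, y - fit X β⟫| := by
  have h1 := h.inner_le hn hlam (β - Pi.single j (β j))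
  have h2 : ∑ i, |(β - Pi.single j (β j) : Fin p → ℝ) i| - ∑ i, |β i| = -|β j| := by
    rw [← Finset.sum_sub_distrib, Finset.sum_eq_single j]
    · simp
    · intro i _ hi; simp [hi]
    · simp
  rw [h2, fit_sub, fit_single, sub_sub_cancel_left, inner_neg_right, real_inner_smul_right,
    real_inner_comm] at h1
  have h3 := le_abs_self (β j * ⟪column X j, y - fit X β⟫)
  rw [abs_mul] at h3
  have h4 := abs_pos.2 hj
  refine le_of_mul_le_mul_left ?_ h4
  linarith

end Lasso

/-! ### Spectral and restricted eigenvalue bounds -/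

section Design

variable {n p : ℕ}

theorem isHermitian_gram (X : Matrix (Fin n) (Fin p) ℝ) : (gram X).IsHermitian := by
  rw [Matrix.IsHermitian, gram, Matrix.conjTranspose_eq_transpose_of_trivial,
    Matrix.transpose_smul, Matrix.transpose_mul, Matrix.transpose_transpose]

theorem dotProduct_gram (X : Matrix (Fin n) (Fin p) ℝ) (v : Fin p → ℝ) :
    v ⬝ᵥ (gram X *ᵥ v) = 1 / (n : ℝ) * ‖fit X v‖ ^ 2 := by
  rw [gram, Matrix.smul_mulVec, dotProduct_smul, smul_eq_mul, ← Matrix.mulVec_mulVec,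
    Matrix.dotProduct_mulVec, Matrix.vecMul_transpose, EuclideanSpace.real_norm_sq_eq]
  congr 1
  exact Finset.sum_congr rfl fun i _ => by simp [fit, sq]

/-- An eigenvalue μ of φ_max I - XᵀX/n makes φ_max - μ an eigenvalue of XᵀX/n, hence at most φ_max;
so μ ≥ 0 and the difference is positive semidefinite. -/
theorem norm_fit_sq_le (hn : 0 < n) (X : Matrix (Fin n) (Fin p) ℝ) (v : Fin p → ℝ) :
    ‖fit X v‖ ^ 2 ≤ n * phiMax X * ∑ j, v j ^ 2 := by
  have hn' : (0 : ℝ) < n := by exact_mod_cast hn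
  have hM : (phiMax X • (1 : Matrix (Fin p) (Fin p) ℝ) - gram X).IsHermitian := by
    refine Matrix.IsHermitian.sub ?_ (isHermitian_gram X)
    rw [Matrix.IsHermitian]
    simp
  have hpsd : (phiMax X • (1 : Matrix (Fin p) (Fin p) ℝ) - gram X).PosSemidef := by
    rw [hM.posSemidef_iff_eigenvalues_nonneg]
    intro i
    have h1 := hM.mulVec_eigenvectorBasis i
    have hne : (hM.eigenvectorBasis i).ofLp ≠ 0 := by
      intro h
      exact hM.eigenvectorBasis.orthonormal.ne_zero i (WithLp.ofLp_injective 2 h)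
    rw [Matrix.sub_mulVec, Matrix.smul_mulVec, Matrix.one_mulVec] at h1
    have h2 : Module.End.HasEigenvalue (Matrix.toLin' (gram X)) (phiMax X - hM.eigenvalues i) := by
      refine Module.End.hasEigenvalue_of_hasEigenvector (x := (hM.eigenvectorBasis i).ofLp)
        ⟨Module.End.mem_eigenspace_iff.2 ?_, hne⟩
      rw [Matrix.toLin'_apply, sub_smul, ← h1]
      simp
    have h3 : phiMax X - hM.eigenvalues i ≤ phiMax X :=
      le_csSup (Module.End.finite_hasEigenvalue _).bddAbove h2
    show 0 ≤ hM.eigenvalues i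
    linarith
  have h := hpsd.dotProduct_mulVec_nonneg v
  rw [Matrix.sub_mulVec, Matrix.smul_mulVec, Matrix.one_mulVec, dotProduct_sub, dotProduct_smul,
    star_trivial, dotProduct_gram, smul_eq_mul] at h
  have h4 : v ⬝ᵥ v = ∑ j, v j ^ 2 := Finset.sum_congr rfl fun j _ => (sq (v j)).symm
  rw [h4] at h
  have h5 : 1 / (n : ℝ) * ‖fit X v‖ ^ 2 ≤ phiMax X * ∑ j, v j ^ 2 := by linarith
  rw [one_div, inv_mul_le_iff₀ hn'] at h5
  linarith

/-- Duality: with v = Xᵀw, |v|² = ⟨Xv, w⟩, and Cauchy-Schwarz with the bound on |Xv| leaves one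
factor |v|² to cancel. -/
theorem sum_inner_column_sq_le (hn : 0 < n) {X : Matrix (Fin n) (Fin p) ℝ}
    (hφ : 0 ≤ phiMax X) (w : EuclideanSpace ℝ (Fin n)) :
    ∑ j, ⟪column X j, w⟫ ^ 2 ≤ n * phiMax X * ‖w‖ ^ 2 := by
  set v : Fin p → ℝ := fun j => ⟪column X j, w⟫ with hv
  have h1 : ⟪fit X v, w⟫ = ∑ j, v j ^ 2 := by
    rw [fit_eq_sum, sum_inner]
    exact Finset.sum_congr rfl fun j _ => by rw [real_inner_smul_left, sq]
  have h2 := norm_fit_sq_le hn X v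
  have h3 := abs_real_inner_le_norm (fit X v) w
  rw [h1] at h3
  change ∑ j, v j ^ 2 ≤ _
  have h0 : 0 ≤ ∑ j, v j ^ 2 := Finset.sum_nonneg fun j _ => sq_nonneg _
  rw [abs_of_nonneg h0] at h3
  rcases h0.eq_or_lt with h | h
  · rw [← h]
    positivity
  · have h4 : (∑ j, v j ^ 2) ^ 2 ≤ (n * phiMax X * ‖w‖ ^ 2) * ∑ j, v j ^ 2 :=
      calc (∑ j, v j ^ 2) ^ 2 ≤ (‖fit X v‖ * ‖w‖) ^ 2 := by gcongr
        _ = ‖fit X v‖ ^ 2 * ‖w‖ ^ 2 := by ring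
        _ ≤ (n * phiMax X * ∑ j, v j ^ 2) * ‖w‖ ^ 2 := by gcongr
        _ = _ := by ring
    rw [sq] at h4
    exact le_of_mul_le_mul_right h4 h

theorem one_le_phiMax (hn : 0 < n) (hp : 0 < p) {X : Matrix (Fin n) (Fin p) ℝ}
    (hX : ∀ j, gram X j j = 1) : 1 ≤ phiMax X := by
  have hn' : (0 : ℝ) < n := by exact_mod_cast hn
  have h := norm_fit_sq_le hn X (Pi.single ⟨0, hp⟩ 1)
  have h5 : ∑ j, (Pi.single ⟨0, hp⟩ 1 : Fin p → ℝ) j ^ 2 = 1 := by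
    rw [Finset.sum_eq_single ⟨0, hp⟩]
    · simp
    · intro i _ hi; simp [hi]
    · simp
  rw [h5, fit_single, one_smul, norm_column_sq hn, hX, mul_one, mul_one] at h
  exact le_of_mul_le_mul_left (by simpa using h) hn'

theorem kappa_le_ratio {X : Matrix (Fin n) (Fin p) ℝ} {s : ℕ} {c : ℝ} {r : ℝ}
    (hr : r ∈ reRatios X s c) : kappa X s c ≤ r :=
  csInf_le ⟨0, by rintro _ ⟨T, δ, _, _, _, rfl⟩; positivity⟩ hr

theorem kappa_le_one (hn : 0 < n) (hp : 0 < p) {X : Matrix (Fin n) (Fin p) ℝ}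
    (hX : ∀ j, gram X j j = 1) {s : ℕ} (hs : 1 ≤ s) : kappa X s 3 ≤ 1 := by
  have hn' : (0 : ℝ) < √n := by positivity
  refine kappa_le_ratio ⟨{⟨0, hp⟩}, Pi.single ⟨0, hp⟩ 1, by simpa using hs, ?_, ⟨⟨0, hp⟩, by simp⟩,
    ?_⟩
  · rw [Finset.sum_eq_zero]
    · simp
    · intro j hj
      have : j ≠ ⟨0, hp⟩ := by simpa using hj
      simp [this]
  · have hcol : ‖column X ⟨0, hp⟩‖ = √n := by
      rw [← Real.sqrt_sq (norm_nonneg _), norm_column_sq hn, hX, mul_one]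
    rw [fit_single, one_smul, hcol]
    simp
    rw [div_self hn'.ne']

/-- Cauchy-Schwarz on T passes from the ℓ₂ norm in κ to the ℓ₁ norm. Vectors vanishing on T are not
among the ratios defining κ, but for them the left side is zero. -/
theorem kappa_sq_mul_l1_sq_le (hn : 0 < n) {X : Matrix (Fin n) (Fin p) ℝ} {s : ℕ}
    (hRE : RE X s 3) {T : Finset (Fin p)} (hT : T.card ≤ s) {δ : Fin p → ℝ}
    (hδ : ∑ j ∈ Tᶜ, |δ j| ≤ 3 * ∑ j ∈ T, |δ j|) :
    kappa X s 3 ^ 2 * n * (∑ j ∈ T, |δ j|) ^ 2 ≤ s * ‖fit X δ‖ ^ 2 := by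
  by_cases h0 : ∃ j ∈ T, δ j ≠ 0
  · have hκ : 0 < kappa X s 3 := hRE
    have hle := kappa_le_ratio (X := X) (s := s) (c := 3) ⟨T, δ, hT, hδ, h0, rfl⟩
    have hpos : 0 < ∑ j ∈ T, δ j ^ 2 := by
      obtain ⟨j, hj, hj0⟩ := h0
      exact Finset.sum_pos' (fun _ _ => sq_nonneg _) ⟨j, hj, by positivity⟩
    have hn' : (0 : ℝ) < n := by exact_mod_cast hn
    rw [le_div_iff₀ (by positivity)] at hle
    have h1 : kappa X s 3 ^ 2 * (n * ∑ j ∈ T, δ j ^ 2) ≤ ‖fit X δ‖ ^ 2 := by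
      have := pow_le_pow_left₀ (by positivity) hle 2
      rwa [mul_pow, mul_pow, Real.sq_sqrt hn'.le, Real.sq_sqrt hpos.le] at this
    have h2 : (∑ j ∈ T, |δ j|) ^ 2 ≤ s * ∑ j ∈ T, δ j ^ 2 := by
      have := sq_sum_le_card_mul_sum_sq (s := T) (f := fun j => |δ j|)
      simp only [sq_abs] at this
      refine this.trans ?_
      gcongr
    calc _ ≤ kappa X s 3 ^ 2 * n * (s * ∑ j ∈ T, δ j ^ 2) := by gcongr
      _ = s * (kappa X s 3 ^ 2 * (n * ∑ j ∈ T, δ j ^ 2)) := by ring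
      _ ≤ _ := by gcongr
  · push Not at h0
    rw [Finset.sum_eq_zero fun j hj => by rw [h0 j hj, abs_zero]]
    rw [zero_pow two_ne_zero, mul_zero]
    positivity

end Design

/-! ### Prediction error and sparsity of the Lasso -/

section LassoBounds

variable {n p : ℕ}

theorem abs_inner_fit_le (X : Matrix (Fin n) (Fin p) ℝ) {ξ : EuclideanSpace ℝ (Fin n)} {c : ℝ}
    (hξ : ∀ j, |⟪column X j, ξ⟫| ≤ c) (δ : Fin p → ℝ) :
    |⟪fit X δ, ξ⟫| ≤ c * ∑ j, |δ j| := by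
  rw [fit_eq_sum, sum_inner, Finset.mul_sum]
  refine (Finset.abs_sum_le_sum_abs _ _).trans (Finset.sum_le_sum fun j _ => ?_)
  rw [real_inner_smul_left, abs_mul, mul_comm]
  exact mul_le_mul_of_nonneg_right (hξ j) (abs_nonneg _)

theorem sum_abs_sub_sum_abs_le (β β' : Fin p → ℝ) :
    ∑ j, |β j| - ∑ j, |β' j| ≤
      ∑ j ∈ supp β, |(β - β') j| - ∑ j ∈ (supp β)ᶜ, |(β - β') j| := by
  rw [← Finset.sum_add_sum_compl (supp β), ← Finset.sum_add_sum_compl (supp β) fun j => |β' j|]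
  have h1 : ∑ j ∈ (supp β)ᶜ, |β j| = 0 := Finset.sum_eq_zero fun j hj => by
    have : β j = 0 := by simpa [supp] using hj
    simp [this]
  have h2 : ∑ j ∈ (supp β)ᶜ, |(β - β') j| = ∑ j ∈ (supp β)ᶜ, |β' j| :=
    Finset.sum_congr rfl fun j hj => by
      have : β j = 0 := by simpa [supp] using hj
      simp [this]
  have h3 : ∑ j ∈ supp β, |β j| - ∑ j ∈ supp β, |β' j| ≤ ∑ j ∈ supp β, |(β - β') j| := by
    rw [← Finset.sum_sub_distrib]
    exact Finset.sum_le_sum fun j _ => abs_sub_abs_le_abs_sub _ _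
  linarith

/-- Prediction and sparsity bounds for a Lasso solution whose tuning parameter is seven times the
noise level. -/
theorem IsLasso.bounds (hn : 0 < n) {X : Matrix (Fin n) (Fin p) ℝ} (hφ : 0 ≤ phiMax X) {s : ℕ}
    (hRE : RE X s 3) {lam : ℝ} (hlam : 0 < lam) {βs : Fin p → ℝ} (hβs : (supp βs).card ≤ s)
    {ξ : EuclideanSpace ℝ (Fin n)} (hξ : ∀ j, |⟪column X j, ξ⟫| ≤ n * lam / 7)
    {β : Fin p → ℝ} (h : IsLasso X (fit X βs + ξ) lam β) :
    kappa X s 3 ^ 2 * (‖fit X β - (fit X βs + ξ)‖ ^ 2 - ‖ξ‖ ^ 2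
        + 1 / 8 * ‖fit X β - fit X βs‖ ^ 2) ≤ 8 / 7 * (n * lam ^ 2 * s) ∧
      kappa X s 3 ^ 2 * ‖fit X β - fit X βs‖ ^ 2 ≤ 64 / 49 * (n * lam ^ 2 * s) ∧
      (supp β).card * (36 / 49 * (n * lam ^ 2)) ≤ phiMax X * ‖fit X β - fit X βs‖ ^ 2 := by
  have hn' : (0 : ℝ) < n := by exact_mod_cast hn
  have hκ : 0 < kappa X s 3 := hRE
  set δ : Fin p → ℝ := βs - β with hδ
  have hfit : fit X βs - fit X β = fit X δ := (fit_sub X βs β).symm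
  have hd : ‖fit X β - fit X βs‖ = ‖fit X δ‖ := by rw [norm_sub_rev, hfit]
  have hres : fit X βs + ξ - fit X β = fit X δ + ξ := by rw [← hfit]; abel
  have hres' : ‖fit X β - (fit X βs + ξ)‖ ^ 2 =
      ‖fit X δ‖ ^ 2 + 2 * ⟪fit X δ, ξ⟫ + ‖ξ‖ ^ 2 := by
    rw [norm_sub_rev, hres, norm_add_sq_real]
  set a := ∑ j ∈ supp βs, |δ j| with ha
  set b := ∑ j ∈ (supp βs)ᶜ, |δ j| with hb
  have hab : ∑ j, |δ j| = a + b := (Finset.sum_add_sum_compl _ _).symm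
  have hb0 : 0 ≤ b := Finset.sum_nonneg fun _ _ => abs_nonneg _
  have ha0 : 0 ≤ a := Finset.sum_nonneg fun _ _ => abs_nonneg _
  have hnl : 0 < n * lam := by positivity
  have hvar : ⟪fit X δ, ξ⟫ + ‖fit X δ‖ ^ 2 ≤ n * lam * (a - b) := by
    have h1 := h.inner_le hn hlam.le βs
    rw [hres, hfit, inner_add_left, real_inner_self_eq_norm_sq, real_inner_comm] at h1
    have h2 := mul_le_mul_of_nonneg_left (sum_abs_sub_sum_abs_le βs β) hnl.le
    linarith
  have hnoise := (abs_le.1 (abs_inner_fit_le X hξ δ)).1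
  rw [hab] at hnoise
  rw [hres', hd]
  set d := ‖fit X δ‖ ^ 2 with hdd
  have hd0 : 0 ≤ d := sq_nonneg _
  have hd1 : d ≤ n * lam * (8 / 7 * a - 6 / 7 * b) := by linarith
  have hcone : b ≤ 3 * a := by
    have h1 : 0 ≤ 8 / 7 * a - 6 / 7 * b := nonneg_of_mul_nonneg_right (hd0.trans hd1) hnl
    linarith
  have hre := kappa_sq_mul_l1_sq_le hn hRE hβs hcone
  rw [← ha, ← hdd] at hre
  set κ := kappa X s 3
  set u := n * lam * a with hu
  set W := n * lam ^ 2 * s with hW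
  have hu0 : 0 ≤ u := by positivity
  have hW0 : 0 ≤ W := by positivity
  have hub : 0 ≤ n * lam * b := by positivity
  have hku : κ ^ 2 * u ^ 2 ≤ W * d := by
    calc κ ^ 2 * u ^ 2 = n * lam ^ 2 * (κ ^ 2 * n * a ^ 2) := by rw [hu]; ring
      _ ≤ n * lam ^ 2 * (s * d) := by gcongr
      _ = W * d := by rw [hW]; ring
  refine ⟨?_, ?_, ?_⟩
  · have h1 : 2 * (κ ^ 2 * u) ≤ 8 / 7 * W + 7 / 8 * (κ ^ 2 * d) := by
      refine (pow_le_pow_iff_left₀ (by positivity) (by positivity) two_ne_zero).1 ?_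
      have h2 := mul_le_mul_of_nonneg_left hku (sq_nonneg κ)
      have h3 := sq_nonneg (8 / 7 * W - 7 / 8 * (κ ^ 2 * d))
      nlinarith
    have h2 : d + 2 * ⟪fit X δ, ξ⟫ + ‖ξ‖ ^ 2 - ‖ξ‖ ^ 2 + 1 / 8 * d ≤ 2 * u - 7 / 8 * d := by
      linarith
    have h3 := mul_le_mul_of_nonneg_left h2 (sq_nonneg κ)
    linarith
  · have h1 : d ≤ 8 / 7 * u := by linarith
    rcases hd0.eq_or_lt with h0 | h0
    · rw [← h0, mul_zero]; positivity
    · refine le_of_mul_le_mul_right ?_ h0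
      calc κ ^ 2 * d * d = κ ^ 2 * d ^ 2 := by ring
        _ ≤ κ ^ 2 * (8 / 7 * u) ^ 2 := by gcongr
        _ = 64 / 49 * (κ ^ 2 * u ^ 2) := by ring
        _ ≤ 64 / 49 * (W * d) := by gcongr
        _ = _ := by ring
  · have h1 : ∀ j ∈ supp β, (6 / 7 * (n * lam)) ^ 2 ≤ ⟪column X j, fit X δ⟫ ^ 2 := by
      intro j hj
      have h2 := h.le_abs_inner_column hn hlam.le (j := j) (by simpa [supp] using hj)
      rw [hres, inner_add_right] at h2
      have h3 := abs_add_le ⟪column X j, fit X δ⟫ ⟪column X j, ξ⟫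
      have h4 := hξ j
      rw [← sq_abs ⟪column X j, fit X δ⟫]
      refine pow_le_pow_left₀ (by positivity) ?_ 2
      linarith
    have h2 := Finset.sum_le_sum h1
    rw [Finset.sum_const, nsmul_eq_mul] at h2
    have h3 := sum_inner_column_sq_le hn hφ (fit X δ)
    have h4 : ∑ j ∈ supp β, ⟪column X j, fit X δ⟫ ^ 2 ≤ ∑ j, ⟪column X j, fit X δ⟫ ^ 2 :=
      Finset.sum_le_sum_of_subset_of_nonneg (Finset.subset_univ _) fun _ _ _ => sq_nonneg _
    refine le_of_mul_le_mul_left ?_ hn'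
    calc _ = (supp β).card * (6 / 7 * (n * lam)) ^ 2 := by ring
      _ ≤ n * phiMax X * d := h2.trans (h4.trans h3)
      _ = _ := by ring

/-- Prediction bound for the Q-aggregate of a family containing the support of a Lasso solution, on
the event where the noise is controlled. -/
theorem norm_qAggregate_sub_fit_sq_le (hn : 0 < n) (hp : 0 < p) {X : Matrix (Fin n) (Fin p) ℝ}
    (hX : ∀ j, gram X j j = 1) {s : ℕ} (hs : 1 ≤ s) (hRE : RE X s 3) {σ x lam : ℝ} (hσ : 0 < σ)
    (hx : 1 ≤ x) (hlam : 0 < lam) (hlam2 : n * lam ^ 2 = 98 * σ ^ 2 * (Real.log p + x))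
    {βs : Fin p → ℝ} (hβs : (supp βs).card ≤ s) {ξ : EuclideanSpace ℝ (Fin n)}
    (hξ : ∀ j, |⟪column X j, ξ⟫| ≤ n * lam / 7)
    (hQ : ∀ S, 19 / 10 * ‖proj X S ξ‖ ^ 2 + 2 * ⟪proj X S (fit X βs) - fit X βs, ξ⟫
      - 1 / 10 * ‖proj X S (fit X βs) - fit X βs‖ ^ 2 ≤
        26 * σ ^ 2 * Real.log (1 / weight S) + 20 * σ ^ 2 * x)
    (hM : ∀ S, ‖proj X S ξ‖ ^ 2 ≤ σ ^ 2 * (6 * Real.log (1 / weight S) + 4 * x))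
    {β : Fin p → ℝ} (h : IsLasso X (fit X βs + ξ) lam β) {F : Finset (Finset (Fin p))}
    (hF : supp β ∈ F) {m : EuclideanSpace ℝ (Fin n)}
    (hm : IsQAggregate X F (σ ^ 2) (fit X βs + ξ) m) :
    ‖m - fit X βs‖ ^ 2 ≤ σ ^ 2 * ((128 + 48 * phiMax X) * (s / kappa X s 3 ^ 2) * Real.log p + 24
      + 128 * (s / kappa X s 3 ^ 2) * x + 22 * x) := by
  have hφ : 1 ≤ phiMax X := one_le_phiMax hn hp hX
  have hκ : 0 < kappa X s 3 := hRE
  have hκ1 : kappa X s 3 ≤ 1 := kappa_le_one hn hp hX hs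
  have hL : 0 ≤ Real.log p := Real.log_natCast_nonneg _
  obtain ⟨h1, h2, h3⟩ := h.bounds hn (zero_le_one.trans hφ) hRE hlam hβs hξ
  have h4 := norm_qAggregate_sub_sq_le X hm hQ hF
  have h5 := norm_proj_sub_le X (fit_mem_colSpan_supp X β) (fit X βs + ξ)
  have h6 := norm_proj_sub_le X (fit_mem_colSpan_supp X β) (fit X βs)
  have h5 := pow_le_pow_left₀ (norm_nonneg _) h5 2
  have h6 := pow_le_pow_left₀ (norm_nonneg _) h6 2
  have h7 := hM (supp β)
  have h8 := log_one_div_weight_le hp (supp β)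
  set κ := kappa X s 3
  set L := Real.log p
  set LT := Real.log (1 / weight (supp β))
  set K := (s : ℝ) / κ ^ 2 with hK
  have hκ2 : 0 < κ ^ 2 := by positivity
  have hsK : (s : ℝ) = κ ^ 2 * K := by rw [hK]; field_simp
  have hK1 : 1 ≤ K := by
    rw [hK, one_le_div hκ2]
    have hs' : (1 : ℝ) ≤ s := by exact_mod_cast hs
    have : κ ^ 2 ≤ 1 := pow_le_one₀ hκ.le hκ1
    linarith
  rw [hlam2, hsK] at h1 h2
  rw [hlam2] at h3
  have h1 : ‖fit X β - (fit X βs + ξ)‖ ^ 2 - ‖ξ‖ ^ 2 + 1 / 8 * ‖fit X β - fit X βs‖ ^ 2 ≤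
      112 * σ ^ 2 * (L + x) * K := le_of_mul_le_mul_left (by linarith) hκ2
  have h2 : ‖fit X β - fit X βs‖ ^ 2 ≤ 128 * σ ^ 2 * (L + x) * K :=
    le_of_mul_le_mul_left (by linarith) hκ2
  have hLx : 0 < L + x := by linarith
  -- Both sides carry σ²(L + x), so the sparsity bound is free of x; 16/9 is 128/72, with 72 = 98 ·
  -- 36/49.
  have h9 : ((supp β).card : ℝ) ≤ 16 / 9 * (phiMax X * K) := by
    have := mul_le_mul_of_nonneg_left h2 (zero_le_one.trans hφ)
    refine le_of_mul_le_mul_right (a := 72 * (σ ^ 2 * (L + x))) ?_ (by positivity)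
    linarith
  have h10 := mul_le_mul_of_nonneg_right h9 hL
  have h11 : LT ≤ 16 / 9 * (phiMax X * K * L) + 3 / 2 + 1 / 2 * L := by linarith
  have h12 : ‖m - fit X βs‖ ^ 2 ≤ σ ^ 2 * (112 * (L + x) * K + 107 / 4 * LT + 41 / 2 * x) := by
    linarith
  refine h12.trans (mul_le_mul_of_nonneg_left ?_ (sq_nonneg σ))
  -- The factor 107/4 · 16/9 is below 48. Raising 112 to 128 gains 16(L + x)K ≥ 16(L + x), which
  -- with x ≥ 1 absorbs the rest of the constant 107/4 · 3/2 beyond 24.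
  have h13 : 0 ≤ phiMax X * K * L := by positivity
  have h14 : 0 ≤ (K - 1) * (L + x) := mul_nonneg (by linarith) hLx.le
  linarith

end LassoBounds

/-! ### From exponential tails to expectations -/

section Expectation

/-- A nonnegative variable with an exponential deviation bound has a bounded expectation. -/
theorem integrable_and_integral_le_of_exp_tail {Ω : Type*} [MeasurableSpace Ω] {P : Measure Ω}
    [IsProbabilityMeasure P] {Z : Ω → ℝ} (hZ : AEMeasurable Z P) (hZ0 : ∀ ω, 0 ≤ Z ω) {a b c : ℝ}
    (hb : 0 < b) (hc : 0 ≤ c)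
    (htail : ∀ x, 0 < x → 1 - c * Real.exp (-x) ≤ P.real {ω | Z ω ≤ a + b * x}) :
    Integrable Z P ∧ ∫ ω, Z ω ∂P ≤ a + c * b := by
  set W : Ω → ℝ := fun ω => max ((Z ω - a) / b) 0 with hW
  have hWm : AEMeasurable W P := ((hZ.sub_const a).div_const b).max aemeasurable_const
  have hW0 : ∀ ω, 0 ≤ W ω := fun ω => le_max_right _ _
  have hZW : ∀ ω, Z ω ≤ a + b * W ω := fun ω => by
    have : (Z ω - a) / b ≤ W ω := le_max_left _ _
    rw [div_le_iff₀ hb] at this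
    linarith
  have hexp : Integrable (fun t : ℝ => c * Real.exp (-t)) (volume.restrict (Set.Ioi 0)) :=
    (integrableOn_exp_neg_Ioi 0).const_mul c
  -- Layer-cake formula for the positive part of (Z - a)/b, whose tail at t is at most c e^{-t}.
  have hlint : ∫⁻ ω, ENNReal.ofReal (W ω) ∂P ≤ ENNReal.ofReal c := by
    rw [lintegral_eq_lintegral_meas_lt P (ae_of_all _ hW0) hWm]
    calc ∫⁻ t in Set.Ioi 0, P {ω | t < W ω}
        ≤ ∫⁻ t in Set.Ioi (0 : ℝ), ENNReal.ofReal (c * Real.exp (-t)) := by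
          refine setLIntegral_mono (by fun_prop) fun t ht => ?_
          have ht0 : 0 < t := ht
          have hset : {ω | t < W ω} ⊆ {ω | Z ω ≤ a + b * t}ᶜ := by
            intro ω hω
            have h1 : t < W ω := hω
            rcases lt_max_iff.1 h1 with h2 | h2
            · rw [lt_div_iff₀ hb] at h2
              simp only [Set.mem_compl_iff, Set.mem_ofPred_eq, not_le]
              linarith
            · linarith
          refine (measure_mono hset).trans ?_
          rw [← ENNReal.ofReal_toReal (measure_ne_top P _)]
          refine ENNReal.ofReal_le_ofReal ?_
          have h3 := probReal_compl_eq_one_sub₀ (μ := P) (nullMeasurableSet_le hZ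
            (aemeasurable_const (b := a + b * t)))
          rw [← measureReal_def, h3]
          linarith [htail t ht0]
      _ = ENNReal.ofReal c := by
          rw [← ofReal_integral_eq_lintegral_ofReal hexp
            (ae_of_all _ fun t => mul_nonneg hc (Real.exp_pos _).le), integral_const_mul,
            integral_exp_neg_Ioi_zero, mul_one]
  have hWi : Integrable W P := ⟨hWm.aestronglyMeasurable, by
    rw [hasFiniteIntegral_iff_ofReal (ae_of_all _ hW0)]
    exact hlint.trans_lt ENNReal.ofReal_lt_top⟩
  have hWle : ∫ ω, W ω ∂P ≤ c := by
    rw [integral_eq_lintegral_of_nonneg_ae (ae_of_all _ hW0) hWm.aestronglyMeasurable]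
    exact ENNReal.toReal_le_of_le_ofReal hc hlint
  have hdom : Integrable (fun ω => a + b * W ω) P := (integrable_const a).add (hWi.const_mul b)
  have hZi : Integrable Z P := hdom.mono' hZ.aestronglyMeasurable (ae_of_all _ fun ω => by
    rw [Real.norm_of_nonneg (hZ0 ω)]
    exact hZW ω)
  refine ⟨hZi, (integral_mono hZi hdom hZW).trans ?_⟩
  rw [integral_add (integrable_const a) (hWi.const_mul b), integral_const_mul]
  simp only [integral_const, probReal_univ, one_smul]
  nlinarith

end Expectation

/-! ### The high-probability bound -/

section Probability

variable {n p : ℕ}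

/-- Only outer-measure facts enter, because the minimizers defining the estimator need not be chosen
measurably: a preimage under g has P-measure at most the γ-measure of the set, and P A + P Aᶜ ≥ 1
for every A. -/
theorem one_sub_le_measureReal_of_compl_subset {Ω E : Type*} [MeasurableSpace Ω]
    [MeasurableSpace E] {P : Measure Ω} [IsProbabilityMeasure P] {γ : Measure E} {g : Ω → E}
    (hg : HasLaw g γ P) {A : Set Ω} {B₁ B₂ B₃ : Set E} {ε : ℝ} (hε : 0 ≤ ε)
    (h₁ : γ B₁ ≤ ENNReal.ofReal ε) (h₂ : γ B₂ ≤ ENNReal.ofReal ε) (h₃ : γ B₃ ≤ ENNReal.ofReal ε)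
    (hA : Aᶜ ⊆ g ⁻¹' (B₁ ∪ B₂ ∪ B₃)) : 1 - 3 * ε ≤ P.real A := by
  have h4 : P Aᶜ ≤ ENNReal.ofReal (3 * ε) := by
    calc P Aᶜ ≤ P (g ⁻¹' (B₁ ∪ B₂ ∪ B₃)) := measure_mono hA
      _ ≤ γ (B₁ ∪ B₂ ∪ B₃) := by
        rw [← hg.map_eq]
        exact Measure.le_map_apply hg.aemeasurable _
      _ ≤ γ B₁ + γ B₂ + γ B₃ :=
        (measure_union_le _ _).trans (add_le_add (measure_union_le _ _) le_rfl)
      _ ≤ ENNReal.ofReal ε + ENNReal.ofReal ε + ENNReal.ofReal ε := by gcongr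
      _ = ENNReal.ofReal (3 * ε) := by
        rw [← ENNReal.ofReal_add hε hε, ← ENNReal.ofReal_add (by positivity) hε]
        congr 1
        ring
  have h5 : P.real Aᶜ ≤ 3 * ε := ENNReal.toReal_le_of_le_ofReal (by positivity) h4
  have h6 := measureReal_union_le (μ := P) A Aᶜ
  rw [Set.union_compl_self, probReal_univ] at h6
  linarith

/-- High-probability prediction bound for the Q-aggregate of the supports on the Lasso path. -/
theorem one_sub_le_measureReal_qAggregate (hn : 0 < n) (hp : 0 < p) {σ : ℝ} (hσ : 0 < σ)
    {X : Matrix (Fin n) (Fin p) ℝ} (hX : ∀ j, gram X j j = 1) {s : ℕ} (hs : 1 ≤ s)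
    {βs : Fin p → ℝ} (hβs : (supp βs).card ≤ s) (hRE : RE X s 3)
    {Ω : Type*} [MeasurableSpace Ω] {P : Measure Ω} [IsProbabilityMeasure P]
    {ξ : Ω → EuclideanSpace ℝ (Fin n)}
    (hξ : HasLaw ξ (multivariateGaussian 0 (σ ^ 2 • (1 : Matrix (Fin n) (Fin n) ℝ))) P)
    {path : Ω → ℝ → Fin p → ℝ} (hpath : ∀ ω, IsLassoPath X (fit X βs + ξ ω) (path ω))
    {m : Ω → EuclideanSpace ℝ (Fin n)}
    (hm : ∀ ω, IsQAggregate X (pathSupports (path ω)) (σ ^ 2) (fit X βs + ξ ω) (m ω))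
    {x : ℝ} (hx : 0 < x) :
    1 - 3 * Real.exp (-x) ≤ P.real {ω | ‖m ω - fit X βs‖ ^ 2 ≤
      σ ^ 2 * ((128 + 48 * phiMax X) * (s / kappa X s 3 ^ 2) * Real.log p + 24
        + 128 * (s / kappa X s 3 ^ 2) * x + 22 * x)} := by
  -- For x < 1 the claim is void, since 3e^{-x} > 3/e > 1; the deterministic bound needs x ≥ 1.
  rcases lt_or_ge x 1 with hx1 | hx1
  · refine le_trans ?_ measureReal_nonneg
    have h1 : Real.exp (-1) ≤ Real.exp (-x) := Real.exp_le_exp.2 (by linarith)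
    have h2 := Real.exp_neg_one_gt_d9
    linarith
  have hn' : (0 : ℝ) < n := by exact_mod_cast hn
  have hL : 0 ≤ Real.log p := Real.log_natCast_nonneg _
  set lam := 7 * σ * √(2 * (Real.log p + x)) / √n with hlam
  have hsq : √(n : ℝ) ^ 2 = n := Real.sq_sqrt hn'.le
  have hsn : 0 < √(n : ℝ) := by positivity
  have hlam0 : 0 < lam := by positivity
  have hlam2 : n * lam ^ 2 = 98 * σ ^ 2 * (Real.log p + x) := by
    rw [hlam, div_pow, mul_pow, mul_pow, Real.sq_sqrt (by positivity), hsq]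
    field_simp
    ring
  have hlam7 : n * lam / 7 = σ * (√n * √(2 * (Real.log p + x))) := by
    rw [hlam]
    nth_rewrite 1 [← hsq]
    field_simp
  refine one_sub_le_measureReal_of_compl_subset (hasLaw_inv_smul hσ hξ) (Real.exp_pos _).le
    (stdGaussian_noise_event hn hp hX hx.le)
    (stdGaussian_quadratic_event X (σ⁻¹ • fit X βs) x) (stdGaussian_proj_event X hx.le) ?_
  rw [Set.compl_subset_comm]
  intro ω hω
  simp only [Set.mem_compl_iff, Set.mem_preimage, Set.mem_union, Set.mem_iUnion,
    Set.mem_ofPred_eq, not_or, not_exists, not_lt] at hω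
  obtain ⟨⟨hN, hQ⟩, hM⟩ := hω
  refine norm_qAggregate_sub_fit_sq_le hn hp hX hs hRE hσ hx1 hlam0 hlam2 hβs ?_ ?_ ?_
    (hpath ω lam hlam0.le) ?_ (hm ω)
  · intro j
    have h1 := hN j
    rw [real_inner_smul_right, abs_mul, abs_of_pos (inv_pos.2 hσ), inv_mul_le_iff₀ hσ] at h1
    rwa [hlam7]
  · intro S
    have h1 := hQ S
    rw [proj_smul, proj_smul, ← smul_sub, real_inner_smul_left, real_inner_smul_right, norm_smul,
      norm_smul, mul_pow, mul_pow, Real.norm_of_nonneg (inv_pos.2 hσ).le] at h1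
    have h2 := mul_le_mul_of_nonneg_left h1 (sq_nonneg σ)
    have h3 : σ ^ 2 * σ⁻¹ ^ 2 = 1 := by field_simp
    calc _ = σ ^ 2 * σ⁻¹ ^ 2 * (19 / 10 * ‖proj X S (ξ ω)‖ ^ 2
          + 2 * ⟪proj X S (fit X βs) - fit X βs, ξ ω⟫
          - 1 / 10 * ‖proj X S (fit X βs) - fit X βs‖ ^ 2) := by rw [h3, one_mul]
      _ ≤ _ := by linarith
  · intro S
    have h1 := hM S
    rw [proj_smul, norm_smul, mul_pow, Real.norm_of_nonneg (inv_pos.2 hσ).le, inv_pow,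
      inv_mul_le_iff₀ (by positivity)] at h1
    exact h1
  · simp only [pathSupports, Finset.mem_filter, Finset.mem_univ, true_and]
    exact ⟨lam, hlam0.le, rfl⟩

end Probability

end LassoAgg

/-! ### The main theorem -/

theorem mainTheorem4 {n p : ℕ} (hn : 0 < n) (hp : 0 < p) (σ : ℝ) (hσ : 0 < σ)
    (X : Matrix (Fin n) (Fin p) ℝ) (hX : ∀ j, LassoAgg.gram X j j = 1)
    (s : ℕ) (hs : 1 ≤ s) (hsp : s ≤ p)
    (βstar : Fin p → ℝ) (hβ : (LassoAgg.supp βstar).card ≤ s)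
    (hRE : LassoAgg.RE X s 3)
    {Ω : Type*} [MeasurableSpace Ω] (P : MeasureTheory.Measure Ω)
    [MeasureTheory.IsProbabilityMeasure P]
    (ξ : Ω → EuclideanSpace ℝ (Fin n))
    (hξ : ProbabilityTheory.HasLaw ξ
      (ProbabilityTheory.multivariateGaussian 0 (σ ^ 2 • (1 : Matrix (Fin n) (Fin n) ℝ))) P)
    (y : Ω → EuclideanSpace ℝ (Fin n)) (hy : ∀ ω, y ω = LassoAgg.fit X βstar + ξ ω)
    (path : Ω → ℝ → Fin p → ℝ) (hpath : ∀ ω, LassoAgg.IsLassoPath X (y ω) (path ω))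
    (muhat : Ω → EuclideanSpace ℝ (Fin n)) (hmeas : AEMeasurable muhat P)
    (hmu : ∀ ω, LassoAgg.IsQAggregate X (LassoAgg.pathSupports (path ω)) (σ ^ 2) (y ω) (muhat ω)) :
    (∀ x : ℝ, 0 < x →
      1 - 3 * Real.exp (-x) ≤
        P.real {ω | LassoAgg.empLoss (muhat ω - LassoAgg.fit X βstar) ≤
          (128 + 48 * LassoAgg.phiMax X) * σ ^ 2 * s * Real.log p / (LassoAgg.kappa X s 3 ^ 2 * n)
            + 24 * σ ^ 2 / n
            + 128 * σ ^ 2 * s * x / (LassoAgg.kappa X s 3 ^ 2 * n)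
            + 22 * σ ^ 2 * x / n}) ∧
    MeasureTheory.Integrable
      (fun ω => LassoAgg.empLoss (muhat ω - LassoAgg.fit X βstar)) P ∧
    ∫ ω, LassoAgg.empLoss (muhat ω - LassoAgg.fit X βstar) ∂P ≤
      (128 + 48 * LassoAgg.phiMax X) * σ ^ 2 * s * Real.log p / (LassoAgg.kappa X s 3 ^ 2 * n)
        + 384 * σ ^ 2 * s / (LassoAgg.kappa X s 3 ^ 2 * n)
        + 90 * σ ^ 2 / n := by
  have hn' : (0 : ℝ) < n := by exact_mod_cast hn
  have hκ : 0 < LassoAgg.kappa X s 3 := hRE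
  have hφ := LassoAgg.one_le_phiMax hn hp hX
  have hL : 0 ≤ Real.log p := Real.log_natCast_nonneg _
  have htail : ∀ x : ℝ, 0 < x →
      1 - 3 * Real.exp (-x) ≤
        P.real {ω | LassoAgg.empLoss (muhat ω - LassoAgg.fit X βstar) ≤
          (128 + 48 * LassoAgg.phiMax X) * σ ^ 2 * s * Real.log p / (LassoAgg.kappa X s 3 ^ 2 * n)
            + 24 * σ ^ 2 / n
            + 128 * σ ^ 2 * s * x / (LassoAgg.kappa X s 3 ^ 2 * n)
            + 22 * σ ^ 2 * x / n} := by
    intro x hx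
    refine (LassoAgg.one_sub_le_measureReal_qAggregate hn hp hσ hX hs hβ hRE hξ
      (fun ω => hy ω ▸ hpath ω) (fun ω => hy ω ▸ hmu ω) hx).trans
      (MeasureTheory.measureReal_mono fun ω hω => ?_)
    rw [Set.mem_ofPred_eq] at hω ⊢
    rw [LassoAgg.empLoss]
    refine (mul_le_mul_of_nonneg_left hω (by positivity)).trans (le_of_eq ?_)
    field_simp
  refine ⟨htail, ?_⟩
  -- The tail is affine in x with slope b, so the expectation is at most a + 3b; this gives 384 = 3
  -- · 128 and 90 = 24 + 3 · 22.
  have h := LassoAgg.integrable_and_integral_le_of_exp_tail (P := P)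
    (Z := fun ω => LassoAgg.empLoss (muhat ω - LassoAgg.fit X βstar))
    (a := (128 + 48 * LassoAgg.phiMax X) * σ ^ 2 * s * Real.log p / (LassoAgg.kappa X s 3 ^ 2 * n)
      + 24 * σ ^ 2 / n)
    (b := 128 * σ ^ 2 * s / (LassoAgg.kappa X s 3 ^ 2 * n) + 22 * σ ^ 2 / n) (c := 3)
    (((hmeas.sub_const _).norm.pow_const 2).const_mul _)
    (fun ω => by rw [LassoAgg.empLoss]; positivity) (by positivity) (by norm_num)
    (fun x hx => by
      refine (htail x hx).trans (le_of_eq ?_)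
      congr 1
      ext ω
      rw [Set.mem_ofPred_eq, Set.mem_ofPred_eq]
      ring_nf)
  refine ⟨h.1, h.2.trans (le_of_eq ?_)⟩
  ring
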